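/- **Setting.** Let $\mathcal C$ be a small additive monoidal category (with biadditive $\otimes$ and unit $I$) with chosen left duals: for every object $C$ an object $C^*$ with $\mathrm{ev}_C:C^*\otimes C\to I$ and $\mathrm{db}_C:I\to C\otimes C^*$ satisfying the triangle identities; for $t:C\to D$ let $t^*:D^*\to C^*$ be the dual morphism. Let $u:I\cong I^*$ and $v_{C,D}:D^*\otimes C^*\cong(C\otimes D)^*$ be the canonical isomorphisms. Let $\vartheta_C:C\to C^{**}$ be a monoidal natural isomorphism, that is, a natural isomorphism with $\vartheta_{B\otimes C}=(v_{B,C}^{-1})^*\circ v_{C^*,B^*}\circ(\vartheta_B\otimes\vartheta_C)$ and $\vartheta_I=(u^{-1})^*\circ u$. Let $R$ be a ring, ${}_R\mathcal M_R$ the monoidal category of $R$-$R$-bimodules under $\otimes_R$, and $F:\mathcal C\to{}_R\mathcal M_R$ an additive strong monoidal functor with structure isomorphisms $F_{C,D}:FC\otimes_R FD\to F(C\otimes D)$ and $F_0:R\to FI$, such that every $FC$ is a right dual object of ${}_R\mathcal M_R$ (that is, there are a bimodule $N$ and bimodule maps $N\otimes_R FC\to R$ and $R\to FC\otimes_R N$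 satisfying the triangle identities). Let $H=\int^C FC^*\otimes FC$ be the abelian group generated by symbols $y\otimes_C x$ ($C\in\mathcal C$, $y\in FC^*$, $x\in FC$), biadditive in $(y,x)$, subject to $Ft^*(y)\otimes_C x=y\otimes_D Ft(x)$ for $t:C\to D$, $x\in FC$, $y\in FD^*$. For $r\in R$, $x\in FA$, $x'\in FB$, $y\in FA^*$, $y'\in FB^*$ put $G_0(r)=Fu(F_0(r))$, $G_{A,B}(y\otimes y')=Fv_{A,B}(F_{B^*,A^*}(y'\otimes y))$; for $y\in FB^*$, $x\in FB$ put $\langle y,x\rangle=F_0^{-1}(F\mathrm{ev}_B(F_{B^*,B}(y\otimes x)))\in R$; and write $\sum_i x_B^i\otimes y_B^i=F_{B,B^*}^{-1}(F\mathrm{db}_B(F_0(1)))\in FB\otimes_R FB^*$. **Statement.** The abelian group $H$ is a right $R$-bialgebroid with $$s_H(r)=G_0(1)\otimes_I F_0(r),\qquad t_H(r)=G_0(r)\otimes_I F_0(1),$$ $$(y\otimes_A x)(y'\otimes_B x')=G_{A,B}(y\otimes y')\otimes_{A\otimes B}F_{A,B}(x\otimes x'),$$ $$\Delta_H(y\otimes_B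 x)=\sum_i(y\otimes_B x_B^i)\,\bar\otimes_R\,(y_B^i\otimes_B x),\qquad \varepsilon_H(y\otimes_B x)=\langle y,x\rangle,$$ where $\bar\otimes_R$ denotes the tensor product in which $h\,s_H(r)\,\bar\otimes_R\,h'=h\,\bar\otimes_R\,h'\,t_H(r)$. There is an isomorphism of abelian groups $S:H\to H$ with $$S(y\otimes_B x)=F\vartheta_B(x)\otimes_{B^*}y ,$$ and $S$ is an invertible antipode for $H$, i.e. for all $h,h'\in H$, $r\in R$: * (S-1) $S(t_H(r))=s_H(r)$; * (S-2) $S(hh')=S(h')S(h)$; * (S-3) $S(h_{(2)})_{(1)}\,\bar\otimes_R\,h_{(1)}S(h_{(2)})_{(2)}=S(h)\,\bar\otimes_R\,1_H$; * (S-4) $h_{(2)}S^{-1}(h_{(1)})_{(1)}\,\bar\otimes_R\,S^{-1}(h_{(1)})_{(2)}=1_H\,\bar\otimes_R\,S^{-1}(h)$. So $H$ is a Hopf algebroid. Moreover $S$ is involutive, $S\circ S=\mathrm{id}_H$ (here $\vartheta$, being a monoidal natural isomorphism $\mathrm{id}\Rightarrow(-)^{**}$, is a pivotal structure on $\mathcal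 C$). -/

import Mathlib

open CategoryTheory MonoidalCategory MulOpposite
open scoped TensorProduct

universe w v u

set_option linter.unusedSectionVars false
set_option linter.unusedVariables false

/-! ## Tensor products and bimodules over a noncommutative ring

An `R`-`R`-bimodule is an abelian group `M` with `[Module R M]` (the left action),
`[Module Rᵐᵒᵖ M]` (the right action, `m · r = op r • m`) and `[SMulCommClass R Rᵐᵒᵖ M]`. -/

section BalancedTensor

variable (R : Type*) [Ring R]
variable (M : Type*) [AddCommGroup M] [Module Rᵐᵒᵖ M]
variable (N : Type*) [AddCommGroup N] [Module R N]

/-- The subgroup of `M ⊗_ℤ N` generated by the elements `m · r ⊗ n - m ⊗ r · n`. -/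
def BalTensor.rel : AddSubgroup (M ⊗[ℤ] N) :=
  AddSubgroup.closure
    {z | ∃ (m : M) (r : R) (n : N), z = (op r • m) ⊗ₜ[ℤ] n - m ⊗ₜ[ℤ] (r • n)}

/-- The tensor product `M ⊗_R N` of a right module and a left module over a noncommutative
ring. -/
def BalTensor : Type _ := (M ⊗[ℤ] N) ⧸ BalTensor.rel R M N

instance : AddCommGroup (BalTensor R M N) :=
  inferInstanceAs (AddCommGroup ((M ⊗[ℤ] N) ⧸ BalTensor.rel R M N))

end BalancedTensor

namespace BalTensor

variable {R : Type*} [Ring R]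
variable {M : Type*} [AddCommGroup M] [Module Rᵐᵒᵖ M]
variable {N : Type*} [AddCommGroup N] [Module R N]
variable {M' : Type*} [AddCommGroup M'] [Module Rᵐᵒᵖ M']
variable {N' : Type*} [AddCommGroup N'] [Module R N']
variable {M'' : Type*} [AddCommGroup M''] [Module Rᵐᵒᵖ M'']
variable {N'' : Type*} [AddCommGroup N''] [Module R N'']
variable {P : Type*} [AddCommGroup P]

variable (R) in
/-- The pure tensor `m ⊗ n` in `M ⊗_R N`. -/
def tmul (m : M) (n : N) : BalTensor R M N :=
  QuotientAddGroup.mk' (BalTensor.rel R M N) (m ⊗ₜ[ℤ] n)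

theorem add_tmul (m m' : M) (n : N) : tmul R (m + m') n = tmul R m n + tmul R m' n := by
  simp only [tmul, TensorProduct.add_tmul]; exact map_add _ _ _

theorem tmul_add (m : M) (n n' : N) : tmul R m (n + n') = tmul R m n + tmul R m n' := by
  simp only [tmul, TensorProduct.tmul_add]; exact map_add _ _ _

theorem zero_tmul (n : N) : tmul R (0 : M) n = 0 := by
  simp only [tmul, TensorProduct.zero_tmul]; exact map_zero _

theorem tmul_zero (m : M) : tmul R m (0 : N) = 0 := by
  simp only [tmul, TensorProduct.tmul_zero]; exact map_zero _

theorem smul_tmul (m : M) (r : R) (n : N) : tmul R (op r • m) n = tmul R m (r • n) := by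
  refine (QuotientAddGroup.eq (s := BalTensor.rel R M N)).2 ?_
  have h : (op r • m) ⊗ₜ[ℤ] n - m ⊗ₜ[ℤ] (r • n) ∈ BalTensor.rel R M N :=
    AddSubgroup.subset_closure ⟨m, r, n, rfl⟩
  have h' := neg_mem h
  rwa [neg_sub, sub_eq_neg_add] at h'

@[elab_as_elim]
theorem induction {motive : BalTensor R M N → Prop} (z : BalTensor R M N)
    (zero : motive 0) (tmul : ∀ m n, motive (tmul R m n))
    (add : ∀ a b, motive a → motive b → motive (a + b)) : motive z := by
  obtain ⟨w, rfl⟩ := QuotientAddGroup.mk'_surjective (BalTensor.rel R M N) z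
  induction w using TensorProduct.induction_on with
  | zero => rw [map_zero]; exact zero
  | tmul m n => exact tmul m n
  | add a b ha hb => rw [map_add]; exact add _ _ ha hb

/-- The universal property: a balanced biadditive map induces a map on `M ⊗_R N`. -/
def lift (f : M →+ N →+ P) (hf : ∀ m (r : R) n, f (op r • m) n = f m (r • n)) :
    BalTensor R M N →+ P :=
  QuotientAddGroup.lift (BalTensor.rel R M N)
    (TensorProduct.liftAddHom f (fun k m n => by simp)) (by
      rw [BalTensor.rel, AddSubgroup.closure_le]
      rintro z ⟨m, r, n, rfl⟩
      simp [hf])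

@[simp]
theorem lift_tmul (f : M →+ N →+ P) (hf : ∀ m (r : R) n, f (op r • m) n = f m (r • n))
    (m : M) (n : N) : lift f hf (tmul R m n) = f m n := rfl

@[ext]
theorem hom_ext {f g : BalTensor R M N →+ P} (h : ∀ m n, f (tmul R m n) = g (tmul R m n)) :
    f = g := by
  ext z
  induction z using BalTensor.induction with
  | zero => simp
  | tmul m n => exact h m n
  | add a b ha hb => simp [ha, hb]

/-- `tmul` as a biadditive map. -/
def tmulHom : M →+ N →+ BalTensor R M N :=
  AddMonoidHom.mk' (fun m => AddMonoidHom.mk' (tmul R m) (tmul_add m))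
    (fun m m' => by ext n; exact add_tmul m m' n)

@[simp] theorem tmulHom_apply (m : M) (n : N) : tmulHom (R := R) m n = tmul R m n := rfl

/-- The map `f ⊗_R g` for a right linear `f` and a left linear `g`. -/
def map (f : M →ₗ[Rᵐᵒᵖ] M') (g : N →ₗ[R] N') : BalTensor R M N →+ BalTensor R M' N' :=
  lift ((tmulHom.comp f.toAddMonoidHom).compr₂ (AddMonoidHom.id _) |>.compl₂ g.toAddMonoidHom)
    (fun m r n => by simp [smul_tmul])

@[simp]
theorem map_tmul (f : M →ₗ[Rᵐᵒᵖ] M') (g : N →ₗ[R] N') (m : M) (n : N) :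
    map f g (tmul R m n) = tmul R (f m) (g n) := rfl

section LeftAction

variable [Module R M] [SMulCommClass R Rᵐᵒᵖ M]

variable (M) in
/-- The left action of `r`, as a right linear map. -/
def leftMul (r : R) : M →ₗ[Rᵐᵒᵖ] M where
  toFun m := r • m
  map_add' := smul_add r
  map_smul' s m := smul_comm r s m

@[simp] theorem leftMul_apply (r : R) (m : M) : leftMul M r m = r • m := rfl

/-- The left action `r · (m ⊗ n) = (r · m) ⊗ n`. -/
instance : Module R (BalTensor R M N) where
  smul r := map (leftMul M r) (LinearMap.id : N →ₗ[R] N)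
  one_smul z := by
    refine DFunLike.congr_fun
      (hom_ext (f := map (leftMul M _) (LinearMap.id : N →ₗ[R] N))
        (g := AddMonoidHom.id _)
        fun m n => ?_) z
    simp
  mul_smul r s z := by
    refine DFunLike.congr_fun
      (hom_ext (f := map (leftMul M _) (LinearMap.id : N →ₗ[R] N))
        (g := (map (leftMul M _) (LinearMap.id : N →ₗ[R] N)).comp (map (leftMul M _) (LinearMap.id : N →ₗ[R] N)))
        fun m n => ?_) z
    simp [mul_smul]
  smul_zero r := map_zero _
  smul_add r := map_add _
  add_smul r s z := by
    refine DFunLike.congr_fun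
      (hom_ext (f := map (leftMul M _) (LinearMap.id : N →ₗ[R] N))
        (g := map (leftMul M _) (LinearMap.id : N →ₗ[R] N) + map (leftMul M _) (LinearMap.id : N →ₗ[R] N))
        fun m n => ?_) z
    simp [add_smul, add_tmul]
  zero_smul z := by
    refine DFunLike.congr_fun
      (hom_ext (f := map (leftMul M _) (LinearMap.id : N →ₗ[R] N))
        (g := 0)
        fun m n => ?_) z
    simp [zero_tmul]

@[simp] theorem smul_tmul' (r : R) (m : M) (n : N) : r • tmul R m n = tmul R (r • m) n := rfl

end LeftAction

section RightAction

variable [Module Rᵐᵒᵖ N] [SMulCommClass R Rᵐᵒᵖ N]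

variable (N) in
/-- The right action of `r`, as a left linear map. -/
def rightMul (r : Rᵐᵒᵖ) : N →ₗ[R] N where
  toFun n := r • n
  map_add' := smul_add r
  map_smul' s n := (smul_comm s r n).symm

@[simp] theorem rightMul_apply (r : Rᵐᵒᵖ) (n : N) : rightMul N r n = r • n := rfl

/-- The right action `(m ⊗ n) · r = m ⊗ (n · r)`. -/
instance : Module Rᵐᵒᵖ (BalTensor R M N) where
  smul r := map (LinearMap.id : M →ₗ[Rᵐᵒᵖ] M) (rightMul N r)
  one_smul z := by
    refine DFunLike.congr_fun
      (hom_ext (f := map (LinearMap.id : M →ₗ[Rᵐᵒᵖ] M) (rightMul N _))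
        (g := AddMonoidHom.id _)
        fun m n => ?_) z
    simp
  mul_smul r s z := by
    refine DFunLike.congr_fun
      (hom_ext (f := map (LinearMap.id : M →ₗ[Rᵐᵒᵖ] M) (rightMul N _))
        (g := (map (LinearMap.id : M →ₗ[Rᵐᵒᵖ] M) (rightMul N _)).comp (map (LinearMap.id : M →ₗ[Rᵐᵒᵖ] M) (rightMul N _)))
        fun m n => ?_) z
    simp [mul_smul]
  smul_zero r := map_zero _
  smul_add r := map_add _
  add_smul r s z := by
    refine DFunLike.congr_fun
      (hom_ext (f := map (LinearMap.id : M →ₗ[Rᵐᵒᵖ] M) (rightMul N _))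
        (g := map (LinearMap.id : M →ₗ[Rᵐᵒᵖ] M) (rightMul N _) + map (LinearMap.id : M →ₗ[Rᵐᵒᵖ] M) (rightMul N _))
        fun m n => ?_) z
    simp [add_smul, tmul_add]
  zero_smul z := by
    refine DFunLike.congr_fun
      (hom_ext (f := map (LinearMap.id : M →ₗ[Rᵐᵒᵖ] M) (rightMul N _))
        (g := 0)
        fun m n => ?_) z
    simp [tmul_zero]

@[simp] theorem op_smul_tmul (r : Rᵐᵒᵖ) (m : M) (n : N) :
    r • tmul R m n = tmul R m (r • n) := rfl

end RightAction

instance [Module R M] [SMulCommClass R Rᵐᵒᵖ M] [Module Rᵐᵒᵖ N] [SMulCommClass R Rᵐᵒᵖ N] :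
    SMulCommClass R Rᵐᵒᵖ (BalTensor R M N) where
  smul_comm r s z := by
    induction z using BalTensor.induction with
    | zero => simp
    | tmul m n => simp
    | add a b ha hb => simp only [smul_add, ha, hb]

end BalTensor

/-- Homomorphisms of `R`-`R`-bimodules. -/
structure BimodHom (R : Type*) [Ring R]
    (M : Type*) [AddCommGroup M] [Module R M] [Module Rᵐᵒᵖ M]
    (N : Type*) [AddCommGroup N] [Module R N] [Module Rᵐᵒᵖ N] extends M →+ N where
  map_smul' : ∀ (r : R) (m : M), toFun (r • m) = r • toFun m
  map_op_smul' : ∀ (r : Rᵐᵒᵖ) (m : M), toFun (r • m) = r • toFun m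

namespace BimodHom

variable {R : Type*} [Ring R]
variable {M : Type*} [AddCommGroup M] [Module R M] [Module Rᵐᵒᵖ M]
variable {N : Type*} [AddCommGroup N] [Module R N] [Module Rᵐᵒᵖ N]
variable {P : Type*} [AddCommGroup P] [Module R P] [Module Rᵐᵒᵖ P]

instance : FunLike (BimodHom R M N) M N where
  coe f := f.toFun
  coe_injective f g h := by
    obtain ⟨f, _, _⟩ := f
    obtain ⟨g, _, _⟩ := g
    congr
    exact DFunLike.coe_injective h

instance : AddMonoidHomClass (BimodHom R M N) M N where
  map_add f := f.map_add'
  map_zero f := f.map_zero'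

@[ext] theorem ext {f g : BimodHom R M N} (h : ∀ x, f x = g x) : f = g := DFunLike.ext _ _ h

@[simp] theorem map_smul (f : BimodHom R M N) (r : R) (m : M) : f (r • m) = r • f m :=
  f.map_smul' r m

@[simp] theorem map_op_smul (f : BimodHom R M N) (r : Rᵐᵒᵖ) (m : M) : f (r • m) = r • f m :=
  f.map_op_smul' r m

/-- The underlying map of left modules. -/
def toLeft (f : BimodHom R M N) : M →ₗ[R] N := { f with }

/-- The underlying map of right modules. -/
def toRight (f : BimodHom R M N) : M →ₗ[Rᵐᵒᵖ] N := { f with map_smul' := f.map_op_smul' }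

@[simp] theorem toLeft_apply (f : BimodHom R M N) (m : M) : f.toLeft m = f m := rfl
@[simp] theorem toRight_apply (f : BimodHom R M N) (m : M) : f.toRight m = f m := rfl
@[simp] theorem toAddMonoidHom_apply (f : BimodHom R M N) (m : M) :
    f.toAddMonoidHom m = f m := rfl

variable (R M) in
/-- The identity. -/
def id : BimodHom R M M := ⟨AddMonoidHom.id M, fun _ _ => rfl, fun _ _ => rfl⟩

/-- Composition `g ∘ f`. -/
def comp (g : BimodHom R N P) (f : BimodHom R M N) : BimodHom R M P :=
  ⟨g.toAddMonoidHom.comp f.toAddMonoidHom, fun r m => by simp, fun r m => by simp⟩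

@[simp] theorem id_apply (m : M) : id R M m = m := rfl
@[simp] theorem comp_apply (g : BimodHom R N P) (f : BimodHom R M N) (m : M) :
    g.comp f m = g (f m) := rfl

instance : Zero (BimodHom R M N) := ⟨⟨0, fun _ _ => by simp, fun _ _ => by simp⟩⟩
instance : Add (BimodHom R M N) :=
  ⟨fun f g => ⟨f.toAddMonoidHom + g.toAddMonoidHom, fun _ _ => by simp, fun _ _ => by simp⟩⟩
instance : Neg (BimodHom R M N) :=
  ⟨fun f => ⟨-f.toAddMonoidHom, fun _ _ => by simp, fun _ _ => by simp⟩⟩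

@[simp] theorem zero_apply (m : M) : (0 : BimodHom R M N) m = 0 := rfl
@[simp] theorem add_apply (f g : BimodHom R M N) (m : M) : (f + g) m = f m + g m := rfl
@[simp] theorem neg_apply (f : BimodHom R M N) (m : M) : (-f) m = -f m := rfl

/-- Bimodule homomorphisms form an abelian group under pointwise addition. -/
instance : AddCommGroup (BimodHom R M N) where
  add_assoc f g h := by ext; simp [add_assoc]
  zero_add f := by ext; simp
  add_zero f := by ext; simp
  add_comm f g := by ext; simp [add_comm]
  neg_add_cancel f := by ext; simp
  nsmul := nsmulRec
  zsmul := zsmulRec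

end BimodHom

namespace BalTensor

variable {R : Type*} [Ring R]
variable {M : Type*} [AddCommGroup M] [Module R M] [Module Rᵐᵒᵖ M] [SMulCommClass R Rᵐᵒᵖ M]
variable {N : Type*} [AddCommGroup N] [Module R N] [Module Rᵐᵒᵖ N] [SMulCommClass R Rᵐᵒᵖ N]
variable {P : Type*} [AddCommGroup P] [Module R P] [Module Rᵐᵒᵖ P] [SMulCommClass R Rᵐᵒᵖ P]
variable {M' : Type*} [AddCommGroup M'] [Module R M'] [Module Rᵐᵒᵖ M'] [SMulCommClass R Rᵐᵒᵖ M']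
variable {N' : Type*} [AddCommGroup N'] [Module R N'] [Module Rᵐᵒᵖ N'] [SMulCommClass R Rᵐᵒᵖ N']

/-- A balanced biadditive map that respects the outer actions induces a bimodule map. -/
def bimodLift (f : M →+ N →+ P) (hf : ∀ m (r : R) n, f (op r • m) n = f m (r • n))
    (hl : ∀ (r : R) m n, f (r • m) n = r • f m n)
    (hr : ∀ (r : Rᵐᵒᵖ) m n, f m (r • n) = r • f m n) : BimodHom R (BalTensor R M N) P where
  toAddMonoidHom := lift f hf
  map_smul' r z := by
    change lift f hf (r • z) = r • lift f hf z
    induction z using BalTensor.induction with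
    | zero => simp
    | tmul m n => simp [hl]
    | add a b ha hb => simp only [smul_add, map_add, ha, hb]
  map_op_smul' r z := by
    change lift f hf (r • z) = r • lift f hf z
    induction z using BalTensor.induction with
    | zero => simp
    | tmul m n => simp [hr]
    | add a b ha hb => simp only [smul_add, map_add, ha, hb]

@[simp] theorem bimodLift_tmul (f : M →+ N →+ P) (hf hl hr) (m : M) (n : N) :
    bimodLift (R := R) f hf hl hr (tmul R m n) = f m n := rfl

/-- Two bimodule maps out of `M ⊗_R N` agree if they agree on pure tensors. -/
theorem bimod_ext {f g : BimodHom R (BalTensor R M N) P}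
    (h : ∀ m n, f (tmul R m n) = g (tmul R m n)) : f = g := by
  ext z
  induction z using BalTensor.induction with
  | zero => simp
  | tmul m n => exact h m n
  | add a b ha hb => simp [ha, hb]

/-- The tensor product `f ⊗_R g` of bimodule maps. -/
def bimodMap (f : BimodHom R M M') (g : BimodHom R N N') :
    BimodHom R (BalTensor R M N) (BalTensor R M' N') :=
  bimodLift ((tmulHom.comp f.toAddMonoidHom).compl₂ g.toAddMonoidHom)
    (fun m r n => by simp [smul_tmul]) (fun r m n => by simp) (fun r m n => by simp)

@[simp] theorem bimodMap_tmul (f : BimodHom R M M') (g : BimodHom R N N') (m : M) (n : N) :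
    bimodMap f g (tmul R m n) = tmul R (f m) (g n) := rfl

variable (R M N P) in
/-- The biadditive map `(m ⊗ n, p) ↦ m ⊗ (n ⊗ p)`. -/
def assocFun : BalTensor R M N →+ P →+ BalTensor R M (BalTensor R N P) :=
  lift
    (AddMonoidHom.mk'
      (fun m => AddMonoidHom.mk'
        (fun n => (tmulHom (R := R) (N := BalTensor R N P) m).comp (tmulHom (R := R) n))
        (fun n n' => by ext p; simp [tmul_add]))
      (fun m m' => by ext n p; simp))
    (fun m r n => by ext p; simp [smul_tmul])

@[simp] theorem assocFun_tmul (m : M) (n : N) (p : P) :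
    assocFun R M N P (tmul R m n) p = tmul R m (tmul R n p) := rfl

variable (R M N P) in
/-- The map `(m ⊗ n) ⊗ p ↦ m ⊗ (n ⊗ p)`. -/
def assocHom : BimodHom R (BalTensor R (BalTensor R M N) P) (BalTensor R M (BalTensor R N P)) :=
  bimodLift (assocFun R M N P)
    (fun z r p => by
      induction z using BalTensor.induction with
      | zero => simp only [smul_zero, map_zero, AddMonoidHom.zero_apply]
      | tmul m n => simp only [op_smul_tmul, assocFun_tmul, smul_tmul]
      | add a b ha hb => simp only [smul_add, map_add, AddMonoidHom.add_apply, ha, hb])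
    (fun r z p => by
      induction z using BalTensor.induction with
      | zero => simp only [smul_zero, map_zero, AddMonoidHom.zero_apply]
      | tmul m n => simp only [smul_tmul', assocFun_tmul]
      | add a b ha hb => simp only [smul_add, map_add, AddMonoidHom.add_apply, ha, hb])
    (fun r z p => by
      induction z using BalTensor.induction with
      | zero => simp only [smul_zero, map_zero, AddMonoidHom.zero_apply]
      | tmul m n => simp only [op_smul_tmul, assocFun_tmul]
      | add a b ha hb => simp only [smul_add, map_add, AddMonoidHom.add_apply, ha, hb])

@[simp] theorem assocHom_tmul (m : M) (n : N) (p : P) :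
    assocHom R M N P (tmul R (tmul R m n) p) = tmul R m (tmul R n p) := rfl

variable (R M N P) in
/-- The biadditive map `(m, n ⊗ p) ↦ (m ⊗ n) ⊗ p`. -/
def assocInvFun : M →+ BalTensor R N P →+ BalTensor R (BalTensor R M N) P :=
  AddMonoidHom.mk'
    (fun m => lift
      (AddMonoidHom.mk'
        (fun n => tmulHom (R := R) (N := P) (tmul R m n))
        (fun n n' => by ext p; simp [tmul_add]))
      (fun n r p => by simp [← smul_tmul]))
    (fun m m' => by ext n p; simp [add_tmul])

@[simp] theorem assocInvFun_tmul (m : M) (n : N) (p : P) :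
    assocInvFun R M N P m (tmul R n p) = tmul R (tmul R m n) p := rfl

variable (R M N P) in
/-- The map `m ⊗ (n ⊗ p) ↦ (m ⊗ n) ⊗ p`. -/
def assocInv : BimodHom R (BalTensor R M (BalTensor R N P)) (BalTensor R (BalTensor R M N) P) :=
  bimodLift (assocInvFun R M N P)
    (fun m r z => by
      induction z using BalTensor.induction with
      | zero => simp only [smul_zero, map_zero]
      | tmul n p => simp only [smul_tmul', assocInvFun_tmul, smul_tmul]
      | add a b ha hb => simp only [smul_add, map_add, ha, hb])
    (fun r m z => by
      induction z using BalTensor.induction with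
      | zero => simp only [smul_zero, map_zero]
      | tmul n p => simp only [smul_tmul', assocInvFun_tmul]
      | add a b ha hb => simp only [smul_add, map_add, ha, hb])
    (fun r m z => by
      induction z using BalTensor.induction with
      | zero => simp only [smul_zero, map_zero]
      | tmul n p => simp only [op_smul_tmul, assocInvFun_tmul]
      | add a b ha hb => simp only [smul_add, map_add, ha, hb])

@[simp] theorem assocInv_tmul (m : M) (n : N) (p : P) :
    assocInv R M N P (tmul R m (tmul R n p)) = tmul R (tmul R m n) p := rfl

/-- Maps out of `(M ⊗ N) ⊗ P` are determined on pure tensors. -/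
theorem bimod_ext_left {Q : Type*} [AddCommGroup Q] [Module R Q] [Module Rᵐᵒᵖ Q]
    [SMulCommClass R Rᵐᵒᵖ Q] {f g : BimodHom R (BalTensor R (BalTensor R M N) P) Q}
    (h : ∀ m n p, f (tmul R (tmul R m n) p) = g (tmul R (tmul R m n) p)) : f = g := by
  refine bimod_ext fun z p => ?_
  induction z using BalTensor.induction with
  | zero => simp [zero_tmul]
  | tmul m n => exact h m n p
  | add a b ha hb => simp [add_tmul, ha, hb]

/-- Maps out of `M ⊗ (N ⊗ P)` are determined on pure tensors. -/
theorem bimod_ext_right {Q : Type*} [AddCommGroup Q] [Module R Q] [Module Rᵐᵒᵖ Q]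
    [SMulCommClass R Rᵐᵒᵖ Q] {f g : BimodHom R (BalTensor R M (BalTensor R N P)) Q}
    (h : ∀ m n p, f (tmul R m (tmul R n p)) = g (tmul R m (tmul R n p))) : f = g := by
  refine bimod_ext fun m z => ?_
  induction z using BalTensor.induction with
  | zero => simp [tmul_zero]
  | tmul n p => exact h m n p
  | add a b ha hb => simp [tmul_add, ha, hb]

variable (R M) in
/-- The map `R ⊗_R M → M`, `r ⊗ m ↦ r · m`. -/
def lidHom : BimodHom R (BalTensor R R M) M :=
  bimodLift
    (AddMonoidHom.mk' (fun r : R => AddMonoidHom.mk' (fun m : M => r • m) (smul_add r))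
      (fun r s => by ext m; simp [add_smul]))
    (fun m r n => by simp [mul_smul]) (fun r m n => by simp [mul_smul])
    (fun r m n => by simp [smul_comm])

@[simp] theorem lidHom_tmul (r : R) (m : M) : lidHom R M (tmul R r m) = r • m := rfl

variable (R M) in
/-- The map `M ⊗_R R → M`, `m ⊗ r ↦ m · r`. -/
def ridHom : BimodHom R (BalTensor R M R) M :=
  bimodLift
    (AddMonoidHom.mk' (fun m : M => AddMonoidHom.mk' (fun r : R => op r • m)
        (fun r s => by simp [add_smul]))
      (fun m m' => by ext r; simp))
    (fun m r n => by simp [mul_smul]) (fun r m n => by simp [smul_comm])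
    (fun r m n => by simp [mul_smul])

@[simp] theorem ridHom_tmul (m : M) (r : R) : ridHom R M (tmul R m r) = op r • m := rfl

variable (R M) in
/-- The map `m ↦ 1 ⊗ m`. -/
def lidInv : BimodHom R M (BalTensor R R M) where
  toAddMonoidHom := tmulHom (R := R) (1 : R)
  map_smul' r m := by
    change tmul R 1 (r • m) = r • tmul R 1 m
    simp [← smul_tmul]
  map_op_smul' r m := rfl

@[simp] theorem lidInv_apply (m : M) : lidInv R M m = tmul R 1 m := rfl

variable (R M) in
/-- The map `m ↦ m ⊗ 1`. -/
def ridInv : BimodHom R M (BalTensor R M R) where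
  toAddMonoidHom := (tmulHom (R := R)).flip (1 : R)
  map_smul' r m := rfl
  map_op_smul' r m := by
    change tmul R (r • m) 1 = r • tmul R m 1
    obtain ⟨r, rfl⟩ := op_surjective r
    simp [smul_tmul]

@[simp] theorem ridInv_apply (m : M) : ridInv R M m = tmul R m 1 := rfl

end BalTensor

/-! ## The monoidal category of bimodules -/

/-- The category of `R`-`R`-bimodules. -/
structure BimodCat (R : Type w) [Ring R] where
  /-- The underlying type. -/
  carrier : Type w
  [addCommGroup : AddCommGroup carrier]
  [left : Module R carrier]
  [right : Module Rᵐᵒᵖ carrier]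
  [comm : SMulCommClass R Rᵐᵒᵖ carrier]

namespace BimodCat

variable {R : Type w} [Ring R]

instance : CoeSort (BimodCat R) (Type w) := ⟨carrier⟩

attribute [instance] addCommGroup left right comm

instance : Category (BimodCat R) where
  Hom M N := BimodHom R M N
  id M := BimodHom.id R M
  comp f g := g.comp f

instance : ConcreteCategory (BimodCat R) (fun M N => BimodHom R M N) where
  hom f := f
  ofHom f := f

theorem hom_ext {M N : BimodCat R} {f g : M ⟶ N} (h : ∀ x : M, f x = g x) : f = g :=
  BimodHom.ext h

instance : Preadditive (BimodCat R) where
  homGroup M N := inferInstanceAs (AddCommGroup (BimodHom R M N))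
  add_comp M N P f f' g := BimodHom.ext fun x => map_add (show BimodHom R N.carrier P.carrier from g) _ _
  comp_add M N P f g g' := rfl

/-- The isomorphism of bimodules given by mutually inverse homomorphisms. -/
def mkIso {M N : BimodCat R} (f : BimodHom R M N) (g : BimodHom R N M)
    (h : g.comp f = BimodHom.id R M) (h' : f.comp g = BimodHom.id R N) : M ≅ N where
  hom := f
  inv := g
  hom_inv_id := h
  inv_hom_id := h'

/-- The monoidal structure `⊗_R`, with unit the regular bimodule `R`. -/
instance : MonoidalCategory (BimodCat R) :=
  letI : MonoidalCategoryStruct (BimodCat R) :=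
    { tensorObj := fun M N => ⟨BalTensor R M N⟩
      whiskerLeft := fun M _ _ f => BalTensor.bimodMap (BimodHom.id R M) f
      whiskerRight := fun f N => BalTensor.bimodMap f (BimodHom.id R N)
      tensorHom := fun f g => BalTensor.bimodMap f g
      tensorUnit := ⟨R⟩
      associator := fun M N P => mkIso (BalTensor.assocHom R M N P) (BalTensor.assocInv R M N P)
        (BalTensor.bimod_ext_left fun _ _ _ => rfl) (BalTensor.bimod_ext_right fun _ _ _ => rfl)
      leftUnitor := fun M => mkIso (M := ⟨BalTensor R R M⟩) (BalTensor.lidHom R M)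
        (BalTensor.lidInv R M)
        (BalTensor.bimod_ext fun r m => by
          change BalTensor.tmul R 1 (r • m) = BalTensor.tmul R r m
          rw [← BalTensor.smul_tmul]; simp)
        (BimodHom.ext fun m => by simp)
      rightUnitor := fun M => mkIso (M := ⟨BalTensor R M R⟩) (BalTensor.ridHom R M)
        (BalTensor.ridInv R M)
        (BalTensor.bimod_ext fun m r => by
          change BalTensor.tmul R (op r • m) 1 = BalTensor.tmul R m r
          rw [BalTensor.smul_tmul]; simp)
        (BimodHom.ext fun m => by simp) }
  MonoidalCategory.ofTensorHom
    (id_tensorHom_id := fun M N => BalTensor.bimod_ext fun _ _ => rfl)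
    (id_tensorHom := fun _ _ _ _ => rfl)
    (tensorHom_id := fun _ _ => rfl)
    (tensorHom_comp_tensorHom := fun _ _ _ _ => BalTensor.bimod_ext fun _ _ => rfl)
    (associator_naturality := fun _ _ _ => BalTensor.bimod_ext_left fun _ _ _ => rfl)
    (leftUnitor_naturality := fun f => BalTensor.bimod_ext fun r m =>
      ((f : BimodHom R _ _).map_smul r m).symm)
    (rightUnitor_naturality := fun f => BalTensor.bimod_ext fun m r =>
      ((f : BimodHom R _ _).map_op_smul (op r) m).symm)
    (pentagon := fun _ _ _ _ => by
      refine BalTensor.bimod_ext fun z p => ?_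
      induction z using BalTensor.induction with
      | zero => simp only [BalTensor.zero_tmul]; exact (map_zero _).trans (map_zero _).symm
      | add a b ha hb =>
        simp only [BalTensor.add_tmul]
        exact (map_add _ _ _).trans ((congrArg₂ (· + ·) ha hb).trans (map_add _ _ _).symm)
      | tmul z n =>
        induction z using BalTensor.induction with
        | zero =>
          simp only [BalTensor.zero_tmul]; exact (map_zero _).trans (map_zero _).symm
        | add a b ha hb =>
          simp only [BalTensor.add_tmul]
          exact (map_add _ _ _).trans ((congrArg₂ (· + ·) ha hb).trans (map_add _ _ _).symm)
        | tmul _ _ => rfl)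
    (triangle := fun _ _ => BalTensor.bimod_ext_left fun m r n =>
      (BalTensor.smul_tmul m r n).symm)

end BimodCat

/-! ## Right bialgebroids and antipodes -/

/-- A ring with commuting source and target maps, i.e. an `Rᵐᵒᵖ ⊗ R`-ring. -/
structure EnvRing (R : Type w) [Ring R] where
  /-- The total ring. -/
  carrier : Type v
  [ring : Ring carrier]
  /-- The source map `s`. -/
  source : R →+* carrier
  /-- The target map `t`, an anti-homomorphism on `R`. -/
  target : Rᵐᵒᵖ →+* carrier
  source_target : ∀ (r : R) (r' : Rᵐᵒᵖ), source r * target r' = target r' * source r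

namespace EnvRing

variable {R : Type w} [Ring R]

attribute [instance] EnvRing.ring

/-- The left `R`-action `r · h = h t(r)`. -/
instance (A : EnvRing.{w, v} R) : Module R A.carrier where
  smul r h := h * A.target (op r)
  one_smul h := by change h * _ = h; simp
  mul_smul r s h := by
    change h * _ = h * _ * _
    rw [MulOpposite.op_mul, map_mul, mul_assoc]
  smul_zero r := zero_mul _
  smul_add r h h' := add_mul _ _ _
  add_smul r s h := by change h * _ = h * _ + h * _; rw [MulOpposite.op_add, map_add, mul_add]
  zero_smul h := by change h * _ = 0; simp

/-- The right `R`-action `h · r = h s(r)`. -/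
instance (A : EnvRing.{w, v} R) : Module Rᵐᵒᵖ A.carrier where
  smul r h := h * A.source (unop r)
  one_smul h := by change h * _ = h; simp
  mul_smul r s h := by
    change h * _ = h * _ * _
    rw [MulOpposite.unop_mul, map_mul, mul_assoc]
  smul_zero r := zero_mul _
  smul_add r h h' := add_mul _ _ _
  add_smul r s h := by change h * _ = h * _ + h * _; rw [MulOpposite.unop_add, map_add, mul_add]
  zero_smul h := by change h * _ = 0; simp

instance (A : EnvRing.{w, v} R) : SMulCommClass R Rᵐᵒᵖ A.carrier where
  smul_comm r s h := by
    change h * A.source _ * A.target _ = h * A.target _ * A.source _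
    rw [mul_assoc, mul_assoc, A.source_target]

theorem smul_def (A : EnvRing.{w, v} R) (r : R) (h : A.carrier) :
    r • h = h * A.target (op r) := rfl

theorem op_smul_def (A : EnvRing.{w, v} R) (r : Rᵐᵒᵖ) (h : A.carrier) :
    r • h = h * A.source (unop r) := rfl

/-- The tensor square `H ⊗_R H` with respect to the actions above, so that
`h s(r) ⊗ h' = h ⊗ h' t(r)`. -/
abbrev Square (A : EnvRing.{w, v} R) : Type v := BalTensor R A.carrier A.carrier

/-- Left multiplication by `a`, which is a map of bimodules. -/
def mulLeft (A : EnvRing.{w, v} R) (a : A.carrier) : BimodHom R A.carrier A.carrier where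
  toAddMonoidHom := AddMonoidHom.mulLeft a
  map_smul' r h := (mul_assoc a h _).symm
  map_op_smul' r h := (mul_assoc a h _).symm

/-- Left multiplication on the first tensor factor, `h ⊗ h' ↦ a h ⊗ h'`. -/
def mulFst (A : EnvRing.{w, v} R) (a : A.carrier) : A.Square →+ A.Square :=
  BalTensor.map (A.mulLeft a).toRight LinearMap.id

/-- Left multiplication on the second tensor factor, `h ⊗ h' ↦ h ⊗ a h'`. -/
def mulSnd (A : EnvRing.{w, v} R) (a : A.carrier) : A.Square →+ A.Square :=
  BalTensor.map LinearMap.id (A.mulLeft a).toLeft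

end EnvRing

/-- Right bialgebroids over `R`. In `comul_mul`, the formula for `Δ(h) = ∑ h₁ ⊗ h₂` is stated
for every way of writing `Δ(h)` as a finite sum of pure tensors `a i ⊗ b i`. -/
structure RightBialgebroid (R : Type w) [Ring R] where
  /-- The total ring with its source and target maps. -/
  toEnvRing : EnvRing.{w, v} R
  /-- The comultiplication `Δ`, a map of `R`-bimodules. -/
  comul : BimodHom R toEnvRing.carrier toEnvRing.Square
  /-- The counit `ε`, a map of `R`-bimodules. -/
  counit : BimodHom R toEnvRing.carrier R
  coassoc : ∀ h, BalTensor.assocHom R _ _ _ (BalTensor.bimodMap comul (BimodHom.id R _) (comul h)) =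
    BalTensor.bimodMap (BimodHom.id R _) comul (comul h)
  counit_comul : ∀ h,
    BalTensor.lidHom R _ (BalTensor.bimodMap counit (BimodHom.id R _) (comul h)) = h
  comul_counit : ∀ h,
    BalTensor.ridHom R _ (BalTensor.bimodMap (BimodHom.id R _) counit (comul h)) = h
  /-- `Δ` takes values in the Takeuchi product: `∑ s(r) h₁ ⊗ h₂ = ∑ h₁ ⊗ t(r) h₂`. -/
  takeuchi : ∀ (r : R) h, toEnvRing.mulFst (toEnvRing.source r) (comul h) =
    toEnvRing.mulSnd (toEnvRing.target (op r)) (comul h)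
  comul_one : comul 1 = BalTensor.tmul R 1 1
  /-- `Δ(h h') = ∑ h₁ h₁' ⊗ h₂ h₂'`. -/
  comul_mul : ∀ (h h' : toEnvRing.carrier) (m n : ℕ) (a b : Fin m → toEnvRing.carrier)
    (a' b' : Fin n → toEnvRing.carrier),
    comul h = ∑ i, BalTensor.tmul R (a i) (b i) →
    comul h' = ∑ j, BalTensor.tmul R (a' j) (b' j) →
    comul (h * h') = ∑ i, ∑ j, BalTensor.tmul R (a i * a' j) (b i * b' j)
  counit_one : counit 1 = 1
  counit_source_mul : ∀ h h', counit (toEnvRing.source (counit h) * h') = counit (h * h')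
  counit_target_mul : ∀ h h', counit (toEnvRing.target (op (counit h)) * h') = counit (h * h')

namespace RightBialgebroid

variable {R : Type w} [Ring R] (H : RightBialgebroid.{w, v} R)

/-- The underlying type of the total ring. -/
abbrev carrier : Type v := H.toEnvRing.carrier

/-- The source map. -/
abbrev source : R →+* H.carrier := H.toEnvRing.source

/-- The target map. -/
abbrev target : Rᵐᵒᵖ →+* H.carrier := H.toEnvRing.target

end RightBialgebroid

/-- An invertible antipode of a right bialgebroid: an isomorphism `S` of the additive group that
satisfies the following four axioms. -/
structure RightBialgebroid.IsAntipode {R : Type w} [Ring R] (H : RightBialgebroid.{w, v} R)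
    (S : H.carrier ≃+ H.carrier) : Prop where
  /-- `S ∘ t = s`. -/
  map_target : ∀ r : R, S (H.target (op r)) = H.source r
  map_mul : ∀ h h', S (h * h') = S h' * S h
  /-- `∑ S(h₂)₁ ⊗ h₁ S(h₂)₂ = S(h) ⊗ 1`. -/
  antipode : ∀ (h : H.carrier) (n : ℕ) (a b : Fin n → H.carrier),
    H.comul h = ∑ i, BalTensor.tmul R (a i) (b i) →
    ∑ i, H.toEnvRing.mulSnd (a i) (H.comul (S (b i))) = BalTensor.tmul R (S h) 1
  /-- `∑ h₂ S⁻¹(h₁)₁ ⊗ S⁻¹(h₁)₂ = 1 ⊗ S⁻¹(h)`. -/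
  antipode_symm : ∀ (h : H.carrier) (n : ℕ) (a b : Fin n → H.carrier),
    H.comul h = ∑ i, BalTensor.tmul R (a i) (b i) →
    ∑ i, H.toEnvRing.mulFst (b i) (H.comul (S.symm (a i))) = BalTensor.tmul R 1 (S.symm h)

/-! ## Duals in a monoidal category

The dual `C*` of an object `C`, with `ev : C* ⊗ C ⟶ 𝟙` and `db : 𝟙 ⟶ C ⊗ C*`, is the one that
Mathlib writes `Cᘁ`; `RightRigidCategory` is a choice of such a dual for every object. -/

section Duals

variable {C : Type u} [Category.{v} C] [MonoidalCategory C] [RightRigidCategory C]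

/-- The dual object `X*`. -/
abbrev dual (X : C) : C := (RightRigidCategory.rightDual X).rightDual

/-- The evaluation `X* ⊗ X ⟶ 𝟙`. -/
abbrev dualEv (X : C) : dual X ⊗ X ⟶ 𝟙_ C :=
  (RightRigidCategory.rightDual X).exact.evaluation'

/-- The coevaluation `𝟙 ⟶ X ⊗ X*`. -/
abbrev dualDb (X : C) : 𝟙_ C ⟶ X ⊗ dual X :=
  (RightRigidCategory.rightDual X).exact.coevaluation'

/-- The dual morphism `f* : Y* ⟶ X*`. -/
abbrev dualMap {X Y : C} (f : X ⟶ Y) : dual Y ⟶ dual X := fᘁ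

variable (C) in
/-- The canonical isomorphism `u : 𝟙 ≅ 𝟙*`. -/
def dualUnitIso : 𝟙_ C ≅ dual (𝟙_ C) :=
  rightDualIso exactPairingUnit (RightRigidCategory.rightDual (𝟙_ C)).exact

/-- The canonical isomorphism `v : Y* ⊗ X* ≅ (X ⊗ Y)*`. -/
def dualTensorIso (X Y : C) : dual Y ⊗ dual X ≅ dual (X ⊗ Y) :=
  (rightDualTensorIso X Y).symm

variable (C) in
/-- A monoidal natural isomorphism `X ≅ X**` from the identity to the double dual functor, whose
monoidal structure is given by `(v_{X,Y}⁻¹)* ∘ v_{Y*,X*}` and `(u⁻¹)* ∘ u`. -/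
structure MonoidalDoubleDualIso where
  /-- The components. -/
  iso (X : C) : X ≅ dual (dual X)
  naturality : ∀ {X Y : C} (f : X ⟶ Y),
    f ≫ (iso Y).hom = (iso X).hom ≫ dualMap (dualMap f)
  tensor : ∀ X Y : C, (iso (X ⊗ Y)).hom =
    ((iso X).hom ⊗ₘ (iso Y).hom) ≫ (dualTensorIso (dual Y) (dual X)).hom ≫
      dualMap (dualTensorIso X Y).inv
  unit : (iso (𝟙_ C)).hom = (dualUnitIso C).hom ≫ dualMap (dualUnitIso C).inv

end Duals

/-! ## The coend of a strong monoidal functor to bimodules -/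

section Coend

variable {C : Type u} [Category.{v} C] [MonoidalCategory C] [RightRigidCategory C]
variable {R : Type w} [Ring R] (F : C ⥤ BimodCat.{w} R)

open Classical in
/-- The subgroup of `⨁_X F X* ⊗_ℤ F X` generated by the elements
`F f* (y) ⊗ x - y ⊗ F f (x)` for `f : X ⟶ Y`, `x ∈ F X`, `y ∈ F Y*`. -/
def DualCoend.rel : AddSubgroup (DirectSum C fun X => F.obj (dual X) ⊗[ℤ] F.obj X) :=
  AddSubgroup.closure
    {z | ∃ (X Y : C) (f : X ⟶ Y) (y : F.obj (dual Y)) (x : F.obj X),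
      z = DirectSum.of (fun X => F.obj (dual X) ⊗[ℤ] F.obj X) X (F.map (dualMap f) y ⊗ₜ[ℤ] x) -
        DirectSum.of (fun X => F.obj (dual X) ⊗[ℤ] F.obj X) Y (y ⊗ₜ[ℤ] F.map f x)}

/-- The coend `∫^X F X* ⊗ F X` in abelian groups. -/
def DualCoend : Type (max u w) :=
  (DirectSum C fun X => F.obj (dual X) ⊗[ℤ] F.obj X) ⧸ DualCoend.rel F

instance : AddCommGroup (DualCoend F) :=
  inferInstanceAs (AddCommGroup (_ ⧸ DualCoend.rel F))

open Classical in
/-- The class `y ⊗_X x` in the coend of `y ∈ F X*`, `x ∈ F X`. -/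
noncomputable def DualCoend.mk (X : C) (y : F.obj (dual X)) (x : F.obj X) : DualCoend F :=
  QuotientAddGroup.mk' (DualCoend.rel F)
    (DirectSum.of (fun X => F.obj (dual X) ⊗[ℤ] F.obj X) X (y ⊗ₜ[ℤ] x))

variable [F.Monoidal]

namespace FiberFunctor

open Functor.LaxMonoidal Functor.OplaxMonoidal

/-- The monoidal constraint `F_{X,Y}(x ⊗ x')`. -/
def mul {X Y : C} (x : F.obj X) (x' : F.obj Y) : F.obj (X ⊗ Y) :=
  (show BimodHom R (BalTensor R (F.obj X) (F.obj Y)) (F.obj (X ⊗ Y)) from μ F X Y)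
    (BalTensor.tmul R x x')

/-- The unit constraint `F_0(r)`. -/
def unit (r : R) : F.obj (𝟙_ C) :=
  (show BimodHom R R (F.obj (𝟙_ C)) from ε F) r

/-- The monoidal constraint `G_{X,Y}(y ⊗ y') = F v_{X,Y} (F_{Y*,X*}(y' ⊗ y))` of the dual functor
`G X = F X*`. -/
def dualMul {X Y : C} (y : F.obj (dual X)) (y' : F.obj (dual Y)) : F.obj (dual (X ⊗ Y)) :=
  F.map (dualTensorIso X Y).hom (mul F y' y)

/-- The unit constraint `G_0(r) = F u (F_0(r))` of the dual functor `G X = F X*`. -/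
def dualUnit (r : R) : F.obj (dual (𝟙_ C)) :=
  F.map (dualUnitIso C).hom (unit F r)

/-- The pairing `⟨y, x⟩ = F_0⁻¹ (F ev_X (F_{X*,X}(y ⊗ x)))`, for `y ∈ F X*` and `x ∈ F X`. -/
def pairing {X : C} (y : F.obj (dual X)) (x : F.obj X) : R :=
  (show BimodHom R (F.obj (𝟙_ C)) R from η F) (F.map (dualEv X) (mul F y x))

/-- The dual basis element `F_{X,X*}⁻¹ (F db_X (F_0(1)))` of `F X ⊗_R F X*`. -/
def dualBasis (X : C) : BalTensor R (F.obj X) (F.obj (dual X)) :=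
  (show BimodHom R (F.obj (X ⊗ dual X)) (BalTensor R (F.obj X) (F.obj (dual X))) from
    δ F X (dual X)) (F.map (dualDb X) (unit F 1))

end FiberFunctor

end Coend

/-! ### Dual morphisms and evaluation. -/

section DualMorphisms

variable {C : Type u} [Category.{v} C] [MonoidalCategory C] [RightRigidCategory C]

/-! The image under F of the two triangle identities is a dual basis calculus: ∑ xᵢ⟨yᵢ, x⟩ = x and ∑
⟨y, xᵢ⟩yᵢ = y. Hence an element of FX* is determined by its pairings with FX (`pairing_ext`), and an
element of FX ⊗ FX* that reproduces every x is the dual basis (`dualBasis_eq_of_reproducing`).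
Identities about the dual functor G are therefore verified by pairing, with the rules ⟨Ff*(y), x⟩ =
⟨y, Ff(x)⟩, ⟨G₀(r), F₀(s)⟩ = rs and ⟨y·y', x·x'⟩ = ⟨y', ⟨y, x⟩x'⟩.

The coend relation moves a morphism of C from one tensor factor to the other. Applied to associators
and unitors, it turns the coherence of F and G into the ring axioms for H.

The comultiplication inserts a dual basis between y and x. That it respects the coend relation and
that it lands in the Takeuchi product have one cause: a map can be moved across the dual basis to
its mate (`sum_tmul_mate`). Multiplicativity holds because products of dual bases form the dual
basis of a tensor product (`dualBasis_tensor`).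

For the antipode, naturality of ϑ gives well-definedness, and monoidality gives S ∘ t = s and
antimultiplicativity. Naturality at ev_X combined with monoidality gives ⟨ϑy, ϑx⟩ = ⟨y, x⟩
(`toDoubleDual_pairing`), so (ϑ_X)* ∘ ϑ_{X*} acts as the identity on FX*. Together with the coend
relation this is S ∘ S = id, so S is its own inverse. The two remaining axioms collapse a product
over a dual basis to a scalar, through db_X in (S-3) and through ev_{X*} ∘ (ϑ_X ⊗ 1) in (S-4); the
dual basis of X* then reassembles the answer. -/

theorem dualMap_whiskerRight_comp_dualEv {X Y : C} (f : X ⟶ Y) :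
    dualMap f ▷ X ≫ dualEv X = dual Y ◁ f ≫ dualEv Y :=
  rightAdjointMate_comp_evaluation f

/-- The isomorphism u is the mate of the identity of 𝟙 between two duals of the same object, the
chosen one and 𝟙 itself; a mate carries one evaluation to the other. -/
theorem dualUnitIso_whiskerRight_comp_dualEv :
    (dualUnitIso C).hom ▷ 𝟙_ C ≫ dualEv (𝟙_ C) = (ρ_ (𝟙_ C)).hom := by
  have h := @rightAdjointMate_comp_evaluation C _ _ (𝟙_ C) (𝟙_ C)
    (RightRigidCategory.rightDual (𝟙_ C)) (@HasRightDual.mk _ _ _ _ (𝟙_ C) exactPairingUnit) (𝟙 _)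
  rw [MonoidalCategory.whiskerLeft_id, Category.id_comp] at h
  exact h

/-- Likewise v is the mate of the identity between the chosen dual of X ⊗ Y and Y* ⊗ X*, whose
evaluation contracts the inner pair first. On elements this becomes `dualMul_pairing`. -/
theorem dualTensorIso_whiskerRight_comp_dualEv (X Y : C) :
    (dualTensorIso X Y).hom ▷ (X ⊗ Y) ≫ dualEv (X ⊗ Y) =
      (α_ (dual Y) (dual X) (X ⊗ Y)).hom ≫ dual Y ◁ (α_ (dual X) X Y).inv ≫
        dual Y ◁ dualEv X ▷ Y ≫ dual Y ◁ (λ_ Y).hom ≫ dualEv Y := by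
  have h := @rightAdjointMate_comp_evaluation C _ _ (X ⊗ Y) (X ⊗ Y)
    (RightRigidCategory.rightDual (X ⊗ Y))
    (@HasRightDual.mk _ _ _ _ (dual Y ⊗ dual X) ExactPairing.tensor) (𝟙 _)
  rw [MonoidalCategory.whiskerLeft_id, Category.id_comp] at h
  refine Eq.trans h ((ExactPairing.tensor_evaluation).trans ?_)
  -- With the evaluations replaced by arbitrary morphisms, only coherence remains.
  have : ∀ (e : dual X ⊗ X ⟶ 𝟙_ C) (e' : dual Y ⊗ Y ⟶ 𝟙_ C),
    𝟙 _ ⊗≫ dual Y ◁ (e ▷ Y) ⊗≫ e' =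
      (α_ (dual Y) (dual X) (X ⊗ Y)).hom ≫ dual Y ◁ (α_ (dual X) X Y).inv ≫
        dual Y ◁ e ▷ Y ≫ dual Y ◁ (λ_ Y).hom ≫ e' := fun e e' => by monoidal
  exact this _ _

end DualMorphisms

/-! ### Strong monoidal functors on elements: products, units and the pairing. -/

theorem BimodCat.congr_apply {R : Type w} [Ring R] {M N : BimodCat.{w} R} {f g : M ⟶ N} (h : f = g)
    (x : M) : f x = g x := by
  rw [h]

namespace FiberFunctor

open Functor.LaxMonoidal Functor.OplaxMonoidal

variable {C : Type u} [Category.{v} C] [MonoidalCategory C] [RightRigidCategory C]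
variable {R : Type w} [Ring R] (F : C ⥤ BimodCat.{w} R)

theorem map_comp_apply {X Y Z : C} (f : X ⟶ Y) (g : Y ⟶ Z) (x : F.obj X) :
    F.map (f ≫ g) x = F.map g (F.map f x) :=
  BimodCat.congr_apply (F.map_comp f g) x

theorem map_id_apply (X : C) (x : F.obj X) : F.map (𝟙 X) x = x :=
  BimodCat.congr_apply (F.map_id X) x

theorem map_hom_inv_apply {X Y : C} (i : X ≅ Y) (x : F.obj X) :
    F.map i.inv (F.map i.hom x) = x := by
  rw [← map_comp_apply, i.hom_inv_id, map_id_apply]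

theorem map_inv_hom_apply {X Y : C} (i : X ≅ Y) (y : F.obj Y) :
    F.map i.hom (F.map i.inv y) = y := by
  rw [← map_comp_apply, i.inv_hom_id, map_id_apply]

variable [F.Monoidal]

theorem mul_add {X Y : C} (x : F.obj X) (y y' : F.obj Y) :
    mul F x (y + y') = mul F x y + mul F x y' := by
  simp only [mul, BalTensor.tmul_add, map_add]

theorem add_mul {X Y : C} (x x' : F.obj X) (y : F.obj Y) :
    mul F (x + x') y = mul F x y + mul F x' y := by
  simp only [mul, BalTensor.add_tmul, map_add]

/-- The monoidal constraint as a biadditive map. -/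
def mulHom (X Y : C) : F.obj X →+ F.obj Y →+ F.obj (X ⊗ Y) :=
  AddMonoidHom.mk' (fun x => AddMonoidHom.mk' (mul F x) (mul_add F x))
    (fun x x' => by ext y; exact add_mul F x x' y)

theorem zero_mul {X Y : C} (y : F.obj Y) : mul F (0 : F.obj X) y = 0 :=
  map_zero ((mulHom F X Y).flip y)

theorem mul_sum {X Y : C} {ι : Type*} (s : Finset ι) (x : F.obj X) (y : ι → F.obj Y) :
    mul F x (∑ i ∈ s, y i) = ∑ i ∈ s, mul F x (y i) :=
  map_sum (mulHom F X Y x) y s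

theorem sum_mul {X Y : C} {ι : Type*} (s : Finset ι) (x : ι → F.obj X) (y : F.obj Y) :
    mul F (∑ i ∈ s, x i) y = ∑ i ∈ s, mul F (x i) y :=
  map_sum ((mulHom F X Y).flip y) x s

theorem smul_mul {X Y : C} (r : R) (x : F.obj X) (y : F.obj Y) :
    mul F (r • x) y = r • mul F x y := by
  simp only [mul, ← BalTensor.smul_tmul', BimodHom.map_smul]

theorem mul_op_smul {X Y : C} (r : Rᵐᵒᵖ) (x : F.obj X) (y : F.obj Y) :
    mul F x (r • y) = r • mul F x y := by
  simp only [mul, ← BalTensor.op_smul_tmul, BimodHom.map_op_smul]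

theorem op_smul_mul {X Y : C} (r : R) (x : F.obj X) (y : F.obj Y) :
    mul F (op r • x) y = mul F x (r • y) := by
  simp only [mul, BalTensor.smul_tmul]

theorem map_tensor_mul {X Y X' Y' : C} (f : X ⟶ X') (g : Y ⟶ Y') (x : F.obj X) (y : F.obj Y) :
    F.map (f ⊗ₘ g) (mul F x y) = mul F (F.map f x) (F.map g y) :=
  (BimodCat.congr_apply (μ_natural F f g) (BalTensor.tmul R x y)).symm

theorem map_whiskerRight_mul {X Y X' : C} (f : X ⟶ X') (x : F.obj X) (y : F.obj Y) :
    F.map (f ▷ Y) (mul F x y) = mul F (F.map f x) y := by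
  rw [← tensorHom_id, map_tensor_mul, map_id_apply]

theorem map_whiskerLeft_mul {X Y Y' : C} (g : Y ⟶ Y') (x : F.obj X) (y : F.obj Y) :
    F.map (X ◁ g) (mul F x y) = mul F x (F.map g y) := by
  rw [← id_tensorHom, map_tensor_mul, map_id_apply]

theorem map_associator_mul {X Y Z : C} (x : F.obj X) (y : F.obj Y) (z : F.obj Z) :
    F.map (α_ X Y Z).hom (mul F (mul F x y) z) = mul F x (mul F y z) :=
  BimodCat.congr_apply (Functor.LaxMonoidal.associativity F X Y Z)
    (BalTensor.tmul R (BalTensor.tmul R x y) z)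

theorem map_associator_inv_mul {X Y Z : C} (x : F.obj X) (y : F.obj Y) (z : F.obj Z) :
    F.map (α_ X Y Z).inv (mul F x (mul F y z)) = mul F (mul F x y) z := by
  rw [← map_associator_mul, map_hom_inv_apply]

theorem map_leftUnitor_mul {X : C} (r : R) (x : F.obj X) :
    F.map (λ_ X).hom (mul F (unit F r) x) = r • x :=
  (BimodCat.congr_apply (Functor.LaxMonoidal.left_unitality F X)
    (BalTensor.tmul R r x)).symm

theorem map_rightUnitor_mul {X : C} (r : R) (x : F.obj X) :
    F.map (ρ_ X).hom (mul F x (unit F r)) = op r • x :=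
  (BimodCat.congr_apply (Functor.LaxMonoidal.right_unitality F X)
    (BalTensor.tmul R x r)).symm

@[elab_as_elim]
-- The constraint FX ⊗ FY → F(X ⊗ Y) is invertible, hence onto, so products generate F(X ⊗ Y)
-- additively.
theorem mul_induction {X Y : C} {motive : F.obj (X ⊗ Y) → Prop} (z : F.obj (X ⊗ Y))
    (zero : motive 0) (mul : ∀ x y, motive (mul F x y))
    (add : ∀ a b, motive a → motive b → motive (a + b)) : motive z := by
  have key : ∀ t : BalTensor R (F.obj X) (F.obj Y),
      motive ((show BimodHom R (BalTensor R (F.obj X) (F.obj Y)) (F.obj (X ⊗ Y)) from μ F X Y) t) := by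
    intro t
    induction t using BalTensor.induction with
    | zero => rw [map_zero]; exact zero
    | tmul x y => exact mul x y
    | add a b ha hb => rw [map_add]; exact add _ _ ha hb
  have h := BimodCat.congr_apply (Functor.Monoidal.δ_μ F X Y) z
  have h' := key ((show BimodHom R (F.obj (X ⊗ Y)) (BalTensor R (F.obj X) (F.obj Y)) from δ F X Y) z)
  exact (congrArg motive h).mp h'

theorem unit_add (r s : R) : unit F (r + s) = unit F r + unit F s := map_add _ _ _

theorem smul_unit (r s : R) : r • unit F s = unit F (r * s) :=
  (BimodHom.map_smul (show BimodHom R R (F.obj (𝟙_ C)) from ε F) r s).symm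

theorem op_smul_unit (r s : R) : op r • unit F s = unit F (s * r) :=
  (BimodHom.map_op_smul (show BimodHom R R (F.obj (𝟙_ C)) from ε F) (op r) s).symm

/-- The inverse `F_0⁻¹` of the unit constraint. -/
def counit : BimodHom R (F.obj (𝟙_ C)) R := η F

theorem counit_unit (r : R) : counit F (unit F r) = r :=
  BimodCat.congr_apply (Functor.Monoidal.ε_η F) r

theorem unit_counit (x : F.obj (𝟙_ C)) : unit F (counit F x) = x :=
  BimodCat.congr_apply (Functor.Monoidal.η_ε F) x

theorem unit_surjective : Function.Surjective (unit F) := fun x => ⟨_, unit_counit F x⟩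

theorem pairing_eq {X : C} (y : F.obj (dual X)) (x : F.obj X) :
    pairing F y x = counit F (F.map (dualEv X) (mul F y x)) := rfl

theorem map_dualEv_mul {X : C} (y : F.obj (dual X)) (x : F.obj X) :
    F.map (dualEv X) (mul F y x) = unit F (pairing F y x) := by
  rw [pairing_eq, unit_counit]

theorem pairing_add {X : C} (y : F.obj (dual X)) (x x' : F.obj X) :
    pairing F y (x + x') = pairing F y x + pairing F y x' := by
  simp only [pairing_eq, mul_add, map_add]

theorem add_pairing {X : C} (y y' : F.obj (dual X)) (x : F.obj X) :
    pairing F (y + y') x = pairing F y x + pairing F y' x := by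
  simp only [pairing_eq, add_mul, map_add]

/-- The pairing as a biadditive map. -/
def pairingHom (X : C) : F.obj (dual X) →+ F.obj X →+ R :=
  AddMonoidHom.mk' (fun y => AddMonoidHom.mk' (pairing F y) (pairing_add F y))
    (fun y y' => by ext x; exact add_pairing F y y' x)

theorem pairing_zero {X : C} (y : F.obj (dual X)) : pairing F y 0 = 0 :=
  map_zero (pairingHom F X y)

theorem pairing_sum {X : C} {ι : Type*} (s : Finset ι) (y : F.obj (dual X)) (x : ι → F.obj X) :
    pairing F y (∑ i ∈ s, x i) = ∑ i ∈ s, pairing F y (x i) :=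
  map_sum (pairingHom F X y) x s

theorem sum_pairing {X : C} {ι : Type*} (s : Finset ι) (y : ι → F.obj (dual X)) (x : F.obj X) :
    pairing F (∑ i ∈ s, y i) x = ∑ i ∈ s, pairing F (y i) x :=
  map_sum ((pairingHom F X).flip x) y s

theorem smul_pairing {X : C} (r : R) (y : F.obj (dual X)) (x : F.obj X) :
    pairing F (r • y) x = r * pairing F y x := by
  simp only [pairing_eq, smul_mul, BimodHom.map_smul, smul_eq_mul]

theorem pairing_op_smul {X : C} (r : R) (y : F.obj (dual X)) (x : F.obj X) :
    pairing F y (op r • x) = pairing F y x * r := by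
  simp only [pairing_eq, mul_op_smul, BimodHom.map_op_smul, op_smul_eq_mul]

theorem op_smul_pairing {X : C} (r : R) (y : F.obj (dual X)) (x : F.obj X) :
    pairing F (op r • y) x = pairing F y (r • x) := by
  simp only [pairing_eq, op_smul_mul]

/-- This adjunction is what makes f* computable: together with `pairing_ext` it characterises the
action of f* on elements. -/
theorem dualMap_pairing {X Y : C} (f : X ⟶ Y) (y : F.obj (dual Y)) (x : F.obj X) :
    pairing F (F.map (dualMap f) y) x = pairing F y (F.map f x) := by
  rw [pairing_eq, pairing_eq, ← map_whiskerRight_mul, ← map_whiskerLeft_mul, ← map_comp_apply,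
    ← map_comp_apply, dualMap_whiskerRight_comp_dualEv]

theorem dualUnit_pairing (r s : R) : pairing F (dualUnit F r) (unit F s) = r * s := by
  rw [pairing_eq, dualUnit, ← map_whiskerRight_mul, ← map_comp_apply,
    dualUnitIso_whiskerRight_comp_dualEv, map_rightUnitor_mul, op_smul_unit, counit_unit]

theorem dualMul_pairing {X Y : C} (y : F.obj (dual X)) (y' : F.obj (dual Y)) (x : F.obj X)
    (x' : F.obj Y) :
    pairing F (dualMul F y y') (mul F x x') = pairing F y' (pairing F y x • x') := by
  rw [pairing_eq, dualMul, ← map_whiskerRight_mul, ← map_comp_apply,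
    dualTensorIso_whiskerRight_comp_dualEv]
  simp only [map_comp_apply, map_associator_mul, map_whiskerLeft_mul, map_associator_inv_mul,
    map_whiskerRight_mul, map_dualEv_mul, map_leftUnitor_mul, counit_unit]

end FiberFunctor

/-! ### Finite expansions in balanced tensor products. -/

namespace BalTensor

variable {R : Type*} [Ring R] {M : Type*} [AddCommGroup M] [Module Rᵐᵒᵖ M]
variable {N : Type*} [AddCommGroup N] [Module R N]

theorem exists_sum (z : BalTensor R M N) :
    ∃ (n : ℕ) (a : Fin n → M) (b : Fin n → N), z = ∑ i, tmul R (a i) (b i) := by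
  induction z using BalTensor.induction with
  | zero => exact ⟨0, Fin.elim0, Fin.elim0, by simp⟩
  | tmul m n => exact ⟨1, fun _ => m, fun _ => n, by simp⟩
  | add z z' h h' =>
    obtain ⟨n, a, b, rfl⟩ := h
    obtain ⟨n', a', b', rfl⟩ := h'
    exact ⟨n + n', Fin.append a a', Fin.append b b', by simp [Fin.sum_univ_add]⟩

theorem tmul_sum {ι : Type*} (s : Finset ι) (m : M) (n : ι → N) :
    tmul R m (∑ i ∈ s, n i) = ∑ i ∈ s, tmul R m (n i) :=
  map_sum (tmulHom (R := R) m) n s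

theorem sum_tmul {ι : Type*} (s : Finset ι) (m : ι → M) (n : N) :
    tmul R (∑ i ∈ s, m i) n = ∑ i ∈ s, tmul R (m i) n :=
  map_sum ((tmulHom (R := R)).flip n) m s

end BalTensor

/-! ### Dual bases and their characterisation. -/

namespace FiberFunctor

open Functor.LaxMonoidal Functor.OplaxMonoidal

variable {C : Type u} [Category.{v} C] [MonoidalCategory C] [RightRigidCategory C]
variable {R : Type w} [Ring R] (F : C ⥤ BimodCat.{w} R) [F.Monoidal]

/-- The number of terms in a chosen expansion of the dual basis element. -/
noncomputable def basisCard (X : C) : ℕ := (dualBasis F X).exists_sum.choose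

/-- The first tensor factors in a chosen expansion of the dual basis element. -/
noncomputable def basisFst (X : C) : Fin (basisCard F X) → F.obj X :=
  (dualBasis F X).exists_sum.choose_spec.choose

/-- The second tensor factors in a chosen expansion of the dual basis element. -/
noncomputable def basisSnd (X : C) : Fin (basisCard F X) → F.obj (dual X) :=
  (dualBasis F X).exists_sum.choose_spec.choose_spec.choose

theorem dualBasis_eq_sum (X : C) :
    dualBasis F X = ∑ i, BalTensor.tmul R (basisFst F X i) (basisSnd F X i) :=
  (dualBasis F X).exists_sum.choose_spec.choose_spec.choose_spec

theorem map_dualDb_unit_one (X : C) :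
    F.map (dualDb X) (unit F 1) = ∑ i, mul F (basisFst F X i) (basisSnd F X i) := by
  have h := BimodCat.congr_apply (Functor.Monoidal.δ_μ F X (dual X)) (F.map (dualDb X) (unit F 1))
  have h' := congrArg (show BimodHom R (BalTensor R (F.obj X) (F.obj (dual X)))
    (F.obj (X ⊗ dual X)) from μ F X (dual X)) (dualBasis_eq_sum F X)
  rw [map_sum] at h'
  exact Eq.trans h.symm h'

theorem map_dualDb_unit (X : C) (r : R) :
    F.map (dualDb X) (unit F r) = ∑ i, mul F (basisFst F X i) (op r • basisSnd F X i) := by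
  have h : unit F r = op r • unit F 1 := by rw [op_smul_unit, one_mul]
  simp only [h, BimodHom.map_op_smul, map_dualDb_unit_one, Finset.smul_sum, mul_op_smul]

/-- `∑ xᵢ ⟨yᵢ, x⟩ = x`. -/
theorem sum_pairing_basisFst {X : C} (x : F.obj X) :
    ∑ i, op (pairing F (basisSnd F X i) x) • basisFst F X i = x := by
  -- A triangle identity for X, evaluated at F₀(1)·x; the right unitor turns the scalar ⟨yᵢ, x⟩ into
  -- a right action.
  have h := congrArg (fun f => F.map (ρ_ X).hom (F.map f (mul F (unit F 1) x)))
    (RightRigidCategory.rightDual X).exact.evaluation_coevaluation'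
  change F.map _ (F.map (dualDb X ▷ X ≫ (α_ X (dual X) X).hom ≫ X ◁ dualEv X) _) = _ at h
  simpa only [map_comp_apply, map_whiskerRight_mul, map_dualDb_unit_one, sum_mul, map_sum,
    map_associator_mul, map_whiskerLeft_mul, map_dualEv_mul, map_rightUnitor_mul,
    map_leftUnitor_mul, map_inv_hom_apply, one_smul] using h

/-- `∑ ⟨y, xᵢ⟩ yᵢ = y`. -/
theorem sum_pairing_basisSnd {X : C} (y : F.obj (dual X)) :
    ∑ i, pairing F y (basisFst F X i) • basisSnd F X i = y := by
  have h := congrArg (fun f => F.map (λ_ (dual X)).hom (F.map f (mul F y (unit F 1))))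
    (RightRigidCategory.rightDual X).exact.coevaluation_evaluation'
  change F.map _ (F.map (dual X ◁ dualDb X ≫ (α_ (dual X) X (dual X)).inv ≫ dualEv X ▷ dual X) _)
    = _ at h
  simpa only [map_comp_apply, map_whiskerRight_mul, map_dualDb_unit_one, mul_sum, map_sum,
    map_associator_inv_mul, map_whiskerLeft_mul, map_dualEv_mul, map_rightUnitor_mul,
    map_leftUnitor_mul, map_inv_hom_apply, op_one, one_smul] using h

/-- The expansion y = ∑ ⟨y, xᵢ⟩yᵢ involves y only through its pairings. -/
theorem pairing_ext {X : C} {y y' : F.obj (dual X)} (h : ∀ x, pairing F y x = pairing F y' x) :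
    y = y' := by
  rw [← sum_pairing_basisSnd F y, ← sum_pairing_basisSnd F y']
  simp only [h]

/-- An element of `F Y ⊗ F X*` is determined by the map `F X → F Y` it represents. -/
theorem sum_tmul_basisSnd {X Y : C} {ι : Type*} [Fintype ι] (a : ι → F.obj Y)
    (b : ι → F.obj (dual X)) (φ : F.obj X → F.obj Y)
    (h : ∀ x, ∑ k, op (pairing F (b k) x) • a k = φ x) :
    ∑ i, BalTensor.tmul R (φ (basisFst F X i)) (basisSnd F X i) =
      ∑ k, BalTensor.tmul R (a k) (b k) := by
  -- Substituting φ(xᵢ) = ∑ aₖ⟨bₖ, xᵢ⟩ and moving the scalars across the tensor leaves ∑ᵢ ⟨bₖ, xᵢ⟩yᵢ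
  -- = bₖ in the second factor.
  simp only [← h, BalTensor.sum_tmul, BalTensor.smul_tmul]
  rw [Finset.sum_comm]
  simp only [← BalTensor.tmul_sum, sum_pairing_basisSnd]

/-- Both sides represent φ as a map FX → FY. No linearity of φ or ψ need be supplied, which allows
the same statement to serve for F of a morphism and for multiplication by a scalar. -/
theorem sum_tmul_mate {X Y : C} (φ : F.obj X → F.obj Y) (ψ : F.obj (dual Y) → F.obj (dual X))
    (h : ∀ y x, pairing F (ψ y) x = pairing F y (φ x)) :
    ∑ i, BalTensor.tmul R (φ (basisFst F X i)) (basisSnd F X i) =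
      ∑ j, BalTensor.tmul R (basisFst F Y j) (ψ (basisSnd F Y j)) :=
  sum_tmul_basisSnd F _ _ φ fun x => by simp only [h, sum_pairing_basisFst]

theorem dualBasis_eq_of_reproducing {X : C} {ι : Type*} [Fintype ι] (a : ι → F.obj X)
    (b : ι → F.obj (dual X)) (h : ∀ x, ∑ k, op (pairing F (b k) x) • a k = x) :
    dualBasis F X = ∑ k, BalTensor.tmul R (a k) (b k) :=
  (dualBasis_eq_sum F X).trans (sum_tmul_basisSnd F a b id h)

theorem dualBasis_unit : dualBasis F (𝟙_ C) = BalTensor.tmul R (unit F 1) (dualUnit F 1) := by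
  rw [dualBasis_eq_of_reproducing F (fun _ : Fin 1 => unit F 1) (fun _ => dualUnit F 1)]
  · simp
  · intro x
    obtain ⟨r, rfl⟩ := unit_surjective F x
    simp [dualUnit_pairing, op_smul_unit]

/-- The product family reproduces x·x': the inner sum over Y restores ⟨y, x⟩x', the scalar passes
back to the first factor, and the sum over X restores x. -/
theorem dualBasis_tensor (X Y : C) :
    dualBasis F (X ⊗ Y) = ∑ k : Fin (basisCard F X) × Fin (basisCard F Y),
      BalTensor.tmul R (mul F (basisFst F X k.1) (basisFst F Y k.2))
        (dualMul F (basisSnd F X k.1) (basisSnd F Y k.2)) := by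
  refine dualBasis_eq_of_reproducing F _ _ fun z => ?_
  induction z using mul_induction with
  | zero => simp only [pairing_zero, MulOpposite.op_zero, zero_smul, Finset.sum_const_zero]
  | mul x x' =>
    simp only [dualMul_pairing, ← mul_op_smul, Fintype.sum_prod_type, ← mul_sum,
      sum_pairing_basisFst]
    simp only [← op_smul_mul, ← sum_mul, sum_pairing_basisFst]
  | add z z' h h' =>
    simp only [pairing_add, MulOpposite.op_add, add_smul, Finset.sum_add_distrib, h, h']

/-! ### Naturality and coherence of the dual functor G, tested by pairing. -/

theorem dualMul_add {X Y : C} (y : F.obj (dual X)) (y' y'' : F.obj (dual Y)) :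
    dualMul F y (y' + y'') = dualMul F y y' + dualMul F y y'' := by
  simp only [dualMul, add_mul, map_add]

theorem add_dualMul {X Y : C} (y y' : F.obj (dual X)) (y'' : F.obj (dual Y)) :
    dualMul F (y + y') y'' = dualMul F y y'' + dualMul F y' y'' := by
  simp only [dualMul, mul_add, map_add]

theorem dualUnit_add (r s : R) : dualUnit F (r + s) = dualUnit F r + dualUnit F s := by
  simp only [dualUnit, unit_add, map_add]

theorem smul_dualUnit (r s : R) : r • dualUnit F s = dualUnit F (r * s) := by
  simp only [dualUnit, ← smul_unit, BimodHom.map_smul]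

theorem pairing_ext_tensor {X Y : C} {z z' : F.obj (dual (X ⊗ Y))}
    (h : ∀ x y, pairing F z (mul F x y) = pairing F z' (mul F x y)) : z = z' := by
  refine pairing_ext F fun t => ?_
  induction t using mul_induction with
  | zero => simp only [pairing_zero]
  | mul x y => exact h x y
  | add a b ha hb => simp only [pairing_add, ha, hb]

theorem dualMap_whiskerRight_dualMul {X Y X' : C} (f : X ⟶ X') (y : F.obj (dual X'))
    (y' : F.obj (dual Y)) :
    F.map (dualMap (f ▷ Y)) (dualMul F y y') = dualMul F (F.map (dualMap f) y) y' := by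
  refine pairing_ext_tensor F fun x x' => ?_
  simp only [dualMap_pairing, map_whiskerRight_mul, dualMul_pairing]

theorem dualMap_whiskerLeft_dualMul {X Y Y' : C} (g : Y ⟶ Y') (y : F.obj (dual X))
    (y' : F.obj (dual Y')) :
    F.map (dualMap (X ◁ g)) (dualMul F y y') = dualMul F y (F.map (dualMap g) y') := by
  refine pairing_ext_tensor F fun x x' => ?_
  simp only [dualMap_pairing, map_whiskerLeft_mul, dualMul_pairing, BimodHom.map_smul]

theorem dualMap_associator_dualMul {X Y Z : C} (x : F.obj (dual X)) (y : F.obj (dual Y))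
    (z : F.obj (dual Z)) :
    F.map (dualMap (α_ X Y Z).hom) (dualMul F x (dualMul F y z)) =
      dualMul F (dualMul F x y) z := by
  refine pairing_ext_tensor F fun t c => ?_
  induction t using mul_induction with
  | zero => simp only [zero_mul, pairing_zero]
  | mul a b =>
    simp only [dualMap_pairing, map_associator_mul, dualMul_pairing, ← smul_mul]
  | add a b ha hb => simp only [add_mul, pairing_add, ha, hb]

theorem dualMap_leftUnitor {X : C} (r : R) (y : F.obj (dual X)) :
    F.map (dualMap (λ_ X).hom) (op r • y) = dualMul F (dualUnit F r) y := by
  refine pairing_ext_tensor F fun t x => ?_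
  obtain ⟨s, rfl⟩ := unit_surjective F t
  simp only [dualMap_pairing, map_leftUnitor_mul, dualMul_pairing, dualUnit_pairing,
    op_smul_pairing, mul_smul]

theorem dualMap_rightUnitor {X : C} (r : R) (y : F.obj (dual X)) :
    F.map (dualMap (ρ_ X).hom) (r • y) = dualMul F y (dualUnit F r) := by
  refine pairing_ext_tensor F fun x t => ?_
  obtain ⟨s, rfl⟩ := unit_surjective F t
  simp only [dualMap_pairing, map_rightUnitor_mul, dualMul_pairing, smul_unit, dualUnit_pairing,
    smul_pairing, pairing_op_smul, mul_assoc]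

/-- The transpose of `db_X` sends `y'·y ∈ F (X ⊗ X*)*` to the scalar `⟨y', y⟩`. -/
theorem dualMap_dualDb_dualMul {X : C} (y : F.obj (dual X)) (z : F.obj (dual (dual X))) :
    F.map (dualMap (dualDb X)) (dualMul F y z) = dualUnit F (pairing F z y) := by
  refine pairing_ext F fun t => ?_
  obtain ⟨s, rfl⟩ := unit_surjective F t
  simp only [dualMap_pairing, map_dualDb_unit, pairing_sum, dualMul_pairing, dualUnit_pairing]
  rw [← pairing_op_smul]
  -- Only the y paired with z is expanded in the dual basis; the result is the left side term by
  -- term, up to commuting the two actions.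
  conv_rhs => rw [← sum_pairing_basisSnd F y, Finset.smul_sum, pairing_sum]
  simp only [smul_comm]

/-- Pairing β*(G₀(1)) with x·y gives the form defined by β, so any tensor representing that form
equals β*(G₀(1)). It is used for ev_X and for ev_{X*} ∘ (ϑ_X ⊗ 1). -/
theorem dualMap_dualUnit_one {X Y : C} (β : X ⊗ Y ⟶ 𝟙_ C) {ι : Type*} [Fintype ι]
    (a : ι → F.obj (dual X)) (b : ι → F.obj (dual Y))
    (h : ∀ x y, ∑ i, pairing F (b i) (pairing F (a i) x • y) =
      counit F (F.map β (mul F x y))) :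
    F.map (dualMap β) (dualUnit F 1) = ∑ i, dualMul F (a i) (b i) := by
  refine pairing_ext_tensor F fun x y => ?_
  rw [dualMap_pairing, ← unit_counit F (F.map β _), dualUnit_pairing, one_mul, ← h, sum_pairing]
  simp only [dualMul_pairing]

end FiberFunctor

/-- A biadditive map, as a homomorphism of additive groups. -/
def AddMonoidHom.ofBiadditive {M N P : Type*} [AddCommGroup M] [AddCommGroup N] [AddCommGroup P]
    (f : M → N → P) (hr : ∀ m n n', f m (n + n') = f m n + f m n')
    (hl : ∀ m m' n, f (m + m') n = f m n + f m' n) : M →+ N →+ P :=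
  AddMonoidHom.mk' (fun m => AddMonoidHom.mk' (f m) (hr m)) fun m m' => by ext n; exact hl m m' n

@[simp] theorem AddMonoidHom.ofBiadditive_apply {M N P : Type*} [AddCommGroup M] [AddCommGroup N]
    [AddCommGroup P] (f : M → N → P) (hr hl) (m : M) (n : N) :
    AddMonoidHom.ofBiadditive f hr hl m n = f m n := rfl

/-! ### The coend: universal property and ring structure. -/

namespace DualCoend

section Additive

variable {C : Type u} [Category.{v} C] [MonoidalCategory C] [RightRigidCategory C]
variable {R : Type w} [Ring R] (F : C ⥤ BimodCat.{w} R)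

theorem mk_add (X : C) (y : F.obj (dual X)) (x x' : F.obj X) :
    mk F X y (x + x') = mk F X y x + mk F X y x' := by
  simp only [mk, TensorProduct.tmul_add, map_add]
  rfl

theorem add_mk (X : C) (y y' : F.obj (dual X)) (x : F.obj X) :
    mk F X (y + y') x = mk F X y x + mk F X y' x := by
  simp only [mk, TensorProduct.add_tmul, map_add]
  rfl

/-- The class `y ⊗_X x` as a biadditive map. -/
noncomputable def mkHom (X : C) : F.obj (dual X) →+ F.obj X →+ DualCoend F :=
  AddMonoidHom.ofBiadditive (mk F X) (mk_add F X) (add_mk F X)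

theorem mk_sum {X : C} {ι : Type*} (s : Finset ι) (y : F.obj (dual X)) (x : ι → F.obj X) :
    mk F X y (∑ i ∈ s, x i) = ∑ i ∈ s, mk F X y (x i) :=
  map_sum (mkHom F X y) x s

theorem sum_mk {X : C} {ι : Type*} (s : Finset ι) (y : ι → F.obj (dual X)) (x : F.obj X) :
    mk F X (∑ i ∈ s, y i) x = ∑ i ∈ s, mk F X (y i) x :=
  map_sum ((mkHom F X).flip x) y s

theorem mk_dualMap {X Y : C} (f : X ⟶ Y) (y : F.obj (dual Y)) (x : F.obj X) :
    mk F X (F.map (dualMap f) y) x = mk F Y y (F.map f x) := by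
  classical
  refine (QuotientAddGroup.eq (s := rel F)).2 ?_
  have h := neg_mem (AddSubgroup.subset_closure ⟨X, Y, f, y, x, rfl⟩ : _ ∈ rel F)
  rwa [neg_sub, sub_eq_neg_add] at h

@[elab_as_elim]
theorem induction {motive : DualCoend F → Prop} (h : DualCoend F) (zero : motive 0)
    (mk : ∀ X y x, motive (mk F X y x))
    (add : ∀ a b, motive a → motive b → motive (a + b)) : motive h := by
  classical
  obtain ⟨w, rfl⟩ := QuotientAddGroup.mk'_surjective (rel F) h
  induction w using DirectSum.induction_on with
  | zero => rw [map_zero]; exact zero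
  | of X t =>
    induction t using TensorProduct.induction_on with
    | zero => rw [map_zero, map_zero]; exact zero
    | tmul y x => exact mk X y x
    | add a b ha hb => rw [map_add, map_add]; exact add _ _ ha hb
  | add a b ha hb => rw [map_add]; exact add _ _ ha hb

variable {F}

open Classical in
/-- The universal property of the coend. -/
noncomputable def lift {P : Type*} [AddCommGroup P] (f : ∀ X, F.obj (dual X) →+ F.obj X →+ P)
    (hf : ∀ {X Y : C} (g : X ⟶ Y) (y : F.obj (dual Y)) (x : F.obj X),
      f X (F.map (dualMap g) y) x = f Y y (F.map g x)) : DualCoend F →+ P :=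
  QuotientAddGroup.lift (rel F)
    (DirectSum.toAddMonoid fun X => TensorProduct.liftAddHom (f X) fun k m n => by simp) (by
      rw [rel, AddSubgroup.closure_le]
      rintro z ⟨X, Y, g, y, x, rfl⟩
      simp [hf])

@[simp] theorem lift_mk {P : Type*} [AddCommGroup P] (f : ∀ X, F.obj (dual X) →+ F.obj X →+ P)
    (hf) (X : C) (y : F.obj (dual X)) (x : F.obj X) : lift f hf (mk F X y x) = f X y x := by
  classical
  exact DirectSum.toAddMonoid_of (γ := P)
    (β := fun X => F.obj (dual X) ⊗[ℤ] F.obj X)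
    (fun X => TensorProduct.liftAddHom (f X) fun k m n => by simp) X (y ⊗ₜ[ℤ] x)

theorem hom_ext {P : Type*} [AddCommGroup P] {f g : DualCoend F →+ P}
    (h : ∀ X y x, f (mk F X y x) = g (mk F X y x)) : f = g := by
  ext z
  induction z using DualCoend.induction with
  | zero => simp
  | mk X y x => exact h X y x
  | add a b ha hb => simp [ha, hb]

end Additive

open FiberFunctor

variable {C : Type u} [Category.{v} C] [MonoidalCategory C] [RightRigidCategory C]
variable {R : Type w} [Ring R] (F : C ⥤ BimodCat.{w} R) [F.Monoidal]

/-- Left multiplication by `y ⊗_A x`. -/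
noncomputable def mulMk (A : C) (y : F.obj (dual A)) (x : F.obj A) : DualCoend F →+ DualCoend F :=
  lift (fun B => AddMonoidHom.ofBiadditive
      (fun y' x' => mk F (A ⊗ B) (dualMul F y y') (mul F x x'))
      (fun y' a b => by rw [FiberFunctor.mul_add, mk_add]) (fun a b x' => by rw [dualMul_add, add_mk]))
    fun g y' x' => by
      simp only [AddMonoidHom.ofBiadditive_apply]
      -- Compatibility with the relation for g is the relation for A ◁ g.
      rw [← dualMap_whiskerLeft_dualMul, mk_dualMap, map_whiskerLeft_mul]

@[simp] theorem mulMk_mk (A : C) (y : F.obj (dual A)) (x : F.obj A) (B : C) (y' : F.obj (dual B))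
    (x' : F.obj B) :
    mulMk F A y x (mk F B y' x') = mk F (A ⊗ B) (dualMul F y y') (mul F x x') :=
  lift_mk _ _ _ _ _

/-- The multiplication of the coend. -/
noncomputable def mulHom : DualCoend F →+ DualCoend F →+ DualCoend F :=
  lift (fun A => AddMonoidHom.ofBiadditive (mulMk F A)
      (fun y a b => hom_ext fun B y' x' => by simp [FiberFunctor.add_mul, mk_add])
      (fun a b x => hom_ext fun B y' x' => by simp [add_dualMul, add_mk]))
    fun g y x => hom_ext fun B y' x' => by
      simp only [AddMonoidHom.ofBiadditive_apply, mulMk_mk]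
      rw [← dualMap_whiskerRight_dualMul, mk_dualMap, map_whiskerRight_mul]

noncomputable scoped instance : Mul (DualCoend F) := ⟨fun a b => mulHom F a b⟩

noncomputable scoped instance : One (DualCoend F) := ⟨mk F (𝟙_ C) (dualUnit F 1) (unit F 1)⟩

theorem one_def : (1 : DualCoend F) = mk F (𝟙_ C) (dualUnit F 1) (unit F 1) := rfl

theorem mk_mul_mk (A B : C) (y : F.obj (dual A)) (x : F.obj A) (y' : F.obj (dual B))
    (x' : F.obj B) :
    mk F A y x * mk F B y' x' = mk F (A ⊗ B) (dualMul F y y') (mul F x x') :=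
  (DFunLike.congr_fun (lift_mk _ _ A y x) _).trans (mulMk_mk F A y x B y' x')

/-- The coend relation for the right unitor absorbs the factor 𝟙. This and its left counterpart
yield the unit laws, the source and target maps, and all four scalar actions on H. -/
theorem mk_mul_mk_unit (A : C) (y : F.obj (dual A)) (x : F.obj A) (r s : R) :
    mk F A y x * mk F (𝟙_ C) (dualUnit F r) (unit F s) = mk F A (r • y) (op s • x) := by
  rw [mk_mul_mk, ← dualMap_rightUnitor, mk_dualMap, map_rightUnitor_mul]

theorem mk_unit_mul_mk (A : C) (y : F.obj (dual A)) (x : F.obj A) (r s : R) :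
    mk F (𝟙_ C) (dualUnit F r) (unit F s) * mk F A y x = mk F A (op r • y) (s • x) := by
  rw [mk_mul_mk, ← dualMap_leftUnitor, mk_dualMap, map_leftUnitor_mul]

noncomputable scoped instance : NonUnitalNonAssocRing (DualCoend F) :=
  { (inferInstance : AddCommGroup (DualCoend F)) with
    mul := (· * ·)
    left_distrib := fun a b c => map_add (mulHom F a) b c
    right_distrib := fun a b c => map_add ((mulHom F).flip c) a b
    zero_mul := fun a => map_zero ((mulHom F).flip a)
    mul_zero := fun a => map_zero (mulHom F a) }

noncomputable scoped instance : Ring (DualCoend F) :=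
  { (inferInstance : NonUnitalNonAssocRing (DualCoend F)) with
    one := 1
    mul_assoc := fun a b c => by
      induction a using DualCoend.induction with
      | zero => simp only [MulZeroClass.zero_mul]
      | add a a' h h' => simp only [_root_.add_mul, h, h']
      | mk X y x =>
        induction b using DualCoend.induction with
        | zero => simp only [MulZeroClass.zero_mul, MulZeroClass.mul_zero]
        | add a a' h h' => simp only [_root_.add_mul, _root_.mul_add, h, h']
        | mk X' y' x' =>
          induction c using DualCoend.induction with
          | zero => simp only [MulZeroClass.mul_zero]
          | add a a' h h' => simp only [_root_.mul_add, h, h']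
          | mk X'' y'' x'' =>
            simp only [mk_mul_mk]
            -- The two bracketings live over different objects; the coend relation for the
            -- associator identifies them.
            rw [← dualMap_associator_dualMul, mk_dualMap, map_associator_mul]
    one_mul := fun a => by
      induction a using DualCoend.induction with
      | zero => simp only [MulZeroClass.mul_zero]
      | add a a' h h' => simp only [_root_.mul_add, h, h']
      | mk X y x => rw [one_def, mk_unit_mul_mk, op_one, one_smul, one_smul]
    mul_one := fun a => by
      induction a using DualCoend.induction with
      | zero => simp only [MulZeroClass.zero_mul]
      | add a a' h h' => simp only [_root_.add_mul, h, h']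
      | mk X y x => rw [one_def, mk_mul_mk_unit, op_one, one_smul, one_smul]
    zsmul := fun n a => n • a
    nsmul := fun n a => n • a }

/-- The coend with the source map `s(r) = G_0(1) ⊗ F_0(r)` and the target map
`t(r) = G_0(r) ⊗ F_0(1)`. -/
noncomputable def envRing : EnvRing.{w, max u w} R where
  carrier := DualCoend F
  source := RingHom.mk'
    { toFun := fun r => mk F (𝟙_ C) (dualUnit F 1) (unit F r)
      map_one' := rfl
      map_mul' := fun r s => by rw [mk_mul_mk_unit, op_smul_unit, one_smul] }
    fun r s => (congrArg _ (unit_add F r s)).trans (mk_add F _ _ _ _)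
  target := RingHom.mk'
    { toFun := fun r => mk F (𝟙_ C) (dualUnit F (unop r)) (unit F 1)
      map_one' := rfl
      map_mul' := fun r s => by
        rw [mk_mul_mk_unit, smul_dualUnit, op_one, one_smul, unop_mul] }
    fun r s => (congrArg (fun y => mk F _ y _) (dualUnit_add F _ _)).trans (add_mk F _ _ _ _)
  source_target r s := by
    change mk F _ _ _ * mk F _ _ _ = mk F _ _ _ * mk F _ _ _
    rw [mk_mul_mk_unit, mk_mul_mk_unit, smul_dualUnit, smul_dualUnit, op_smul_unit, op_smul_unit]
    simp

end DualCoend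

/-! ### Left multiplications on the tensor square. -/

namespace EnvRing

variable {R : Type w} [Ring R] (A : EnvRing.{w, v} R)

@[simp] theorem mulFst_tmul (a h h' : A.carrier) :
    A.mulFst a (BalTensor.tmul R h h') = BalTensor.tmul R (a * h) h' := rfl

@[simp] theorem mulSnd_tmul (a h h' : A.carrier) :
    A.mulSnd a (BalTensor.tmul R h h') = BalTensor.tmul R h (a * h') := rfl

theorem mulFst_mul (a b : A.carrier) (z : A.Square) :
    A.mulFst (a * b) z = A.mulFst a (A.mulFst b z) :=
  DFunLike.congr_fun (BalTensor.hom_ext (f := A.mulFst (a * b))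
    (g := (A.mulFst a).comp (A.mulFst b)) fun m n => by simp [mul_assoc]) z

theorem mulSnd_mul (a b : A.carrier) (z : A.Square) :
    A.mulSnd (a * b) z = A.mulSnd a (A.mulSnd b z) :=
  DFunLike.congr_fun (BalTensor.hom_ext (f := A.mulSnd (a * b))
    (g := (A.mulSnd a).comp (A.mulSnd b)) fun m n => by simp [mul_assoc]) z

theorem mulFst_add (a b : A.carrier) (z : A.Square) :
    A.mulFst (a + b) z = A.mulFst a z + A.mulFst b z :=
  DFunLike.congr_fun (BalTensor.hom_ext (f := A.mulFst (a + b))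
    (g := A.mulFst a + A.mulFst b) fun m n => by simp [add_mul, BalTensor.add_tmul]) z

theorem mulSnd_add (a b : A.carrier) (z : A.Square) :
    A.mulSnd (a + b) z = A.mulSnd a z + A.mulSnd b z :=
  DFunLike.congr_fun (BalTensor.hom_ext (f := A.mulSnd (a + b))
    (g := A.mulSnd a + A.mulSnd b) fun m n => by simp [add_mul, BalTensor.tmul_add]) z

theorem mulFst_mulSnd (a b : A.carrier) (z : A.Square) :
    A.mulFst a (A.mulSnd b z) = A.mulSnd b (A.mulFst a z) :=
  DFunLike.congr_fun (BalTensor.hom_ext (f := (A.mulFst a).comp (A.mulSnd b))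
    (g := (A.mulSnd b).comp (A.mulFst a)) fun m n => by simp) z

/-- Left multiplication `a ⊗ b ↦ (a ⊗ b) z` onto an element `z` of the Takeuchi product. -/
def mulTakeuchi (z : A.Square)
    (hz : ∀ r : R, A.mulFst (A.source r) z = A.mulSnd (A.target (op r)) z) :
    A.Square →+ A.Square :=
  BalTensor.lift (AddMonoidHom.ofBiadditive (fun a b => A.mulFst a (A.mulSnd b z))
      (fun a b b' => by rw [mulSnd_add, map_add]) (fun a a' b => mulFst_add A a a' _))
    fun a r b => by
      simp only [AddMonoidHom.ofBiadditive_apply, op_smul_def, smul_def, unop_op]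
      -- Balancing is exactly the Takeuchi condition: s(r), brought next to z in the first factor,
      -- reappears as t(r) in the second.
      rw [mulFst_mul, mulFst_mulSnd A (A.source r), hz, mulSnd_mul]

@[simp] theorem mulTakeuchi_tmul (z : A.Square)
    (hz : ∀ r : R, A.mulFst (A.source r) z = A.mulSnd (A.target (op r)) z) (a b : A.carrier) :
    A.mulTakeuchi z hz (BalTensor.tmul R a b) = A.mulFst a (A.mulSnd b z) := rfl

end EnvRing

/-! ### The right bialgebroid structure. -/

namespace DualCoend

open FiberFunctor

variable {C : Type u} [Category.{v} C] [MonoidalCategory C] [RightRigidCategory C]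
variable {R : Type w} [Ring R] (F : C ⥤ BimodCat.{w} R) [F.Monoidal]

/-- The class `y ⊗_X x` as an element of the total ring. -/
noncomputable def cls (X : C) (y : F.obj (dual X)) (x : F.obj X) : (envRing F).carrier :=
  mk F X y x

theorem cls_add (X : C) (y : F.obj (dual X)) (x x' : F.obj X) :
    cls F X y (x + x') = cls F X y x + cls F X y x' := mk_add F X y x x'

theorem add_cls (X : C) (y y' : F.obj (dual X)) (x : F.obj X) :
    cls F X (y + y') x = cls F X y x + cls F X y' x := add_mk F X y y' x

theorem cls_sum {X : C} {ι : Type*} (s : Finset ι) (y : F.obj (dual X)) (x : ι → F.obj X) :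
    cls F X y (∑ i ∈ s, x i) = ∑ i ∈ s, cls F X y (x i) := mk_sum F s y x

theorem sum_cls {X : C} {ι : Type*} (s : Finset ι) (y : ι → F.obj (dual X)) (x : F.obj X) :
    cls F X (∑ i ∈ s, y i) x = ∑ i ∈ s, cls F X (y i) x := sum_mk F s y x

theorem cls_dualMap {X Y : C} (f : X ⟶ Y) (y : F.obj (dual Y)) (x : F.obj X) :
    cls F X (F.map (dualMap f) y) x = cls F Y y (F.map f x) := mk_dualMap F f y x

theorem cls_mul_cls (A B : C) (y : F.obj (dual A)) (x : F.obj A) (y' : F.obj (dual B))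
    (x' : F.obj B) :
    cls F A y x * cls F B y' x' = cls F (A ⊗ B) (dualMul F y y') (mul F x x') :=
  mk_mul_mk F A B y x y' x'

theorem one_eq_cls : (1 : (envRing F).carrier) = cls F (𝟙_ C) (dualUnit F 1) (unit F 1) := rfl

theorem source_eq_cls (r : R) :
    (envRing F).source r = cls F (𝟙_ C) (dualUnit F 1) (unit F r) := rfl

theorem target_eq_cls (r : R) :
    (envRing F).target (op r) = cls F (𝟙_ C) (dualUnit F r) (unit F 1) := rfl

theorem source_mul_cls (X : C) (y : F.obj (dual X)) (x : F.obj X) (r : R) :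
    (envRing F).source r * cls F X y x = cls F X y (r • x) :=
  (mk_unit_mul_mk F X y x 1 r).trans (by rw [op_one, one_smul]; rfl)

theorem target_mul_cls (X : C) (y : F.obj (dual X)) (x : F.obj X) (r : R) :
    (envRing F).target (op r) * cls F X y x = cls F X (op r • y) x :=
  (mk_unit_mul_mk F X y x r 1).trans (by rw [one_smul]; rfl)

theorem smul_cls (X : C) (y : F.obj (dual X)) (x : F.obj X) (r : R) :
    r • cls F X y x = cls F X (r • y) x :=
  (mk_mul_mk_unit F X y x r 1).trans (by rw [op_one, one_smul]; rfl)

theorem op_smul_cls (X : C) (y : F.obj (dual X)) (x : F.obj X) (r : Rᵐᵒᵖ) :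
    r • cls F X y x = cls F X y (r • x) :=
  (mk_mul_mk_unit F X y x 1 (unop r)).trans (by rw [one_smul]; rfl)

@[elab_as_elim]
theorem cls_induction {motive : (envRing F).carrier → Prop} (h : (envRing F).carrier)
    (zero : motive 0) (cls : ∀ X y x, motive (cls F X y x))
    (add : ∀ a b, motive a → motive b → motive (a + b)) : motive h :=
  DualCoend.induction F (motive := motive) h zero cls add

/-- The map `a ⊗ b ↦ (y ⊗_X a) ⊗ (b ⊗_Y x)`. -/
noncomputable def insert {X Y : C} (y : F.obj (dual X)) (x : F.obj Y) :
    BalTensor R (F.obj X) (F.obj (dual Y)) →+ (envRing F).Square :=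
  BalTensor.lift (AddMonoidHom.ofBiadditive
      (fun a b => BalTensor.tmul R (cls F X y a) (cls F Y b x))
      (fun a b b' => by rw [add_cls, BalTensor.tmul_add])
      (fun a a' b => by rw [cls_add, BalTensor.add_tmul]))
    fun a r b => by
      simp only [AddMonoidHom.ofBiadditive_apply, ← smul_cls, ← op_smul_cls, BalTensor.smul_tmul]

@[simp] theorem insert_tmul {X Y : C} (y : F.obj (dual X)) (x : F.obj Y) (a : F.obj X)
    (b : F.obj (dual Y)) :
    insert F y x (BalTensor.tmul R a b) = BalTensor.tmul R (cls F X y a) (cls F Y b x) := rfl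

theorem sum_insert_mate {X Y : C} (y : F.obj (dual Y)) (x : F.obj X)
    (φ : F.obj X → F.obj Y) (ψ : F.obj (dual Y) → F.obj (dual X))
    (h : ∀ y x, pairing F (ψ y) x = pairing F y (φ x)) :
    ∑ i, BalTensor.tmul R (cls F Y y (φ (basisFst F X i))) (cls F X (basisSnd F X i) x) =
      ∑ j, BalTensor.tmul R (cls F Y y (basisFst F Y j)) (cls F X (ψ (basisSnd F Y j)) x) := by
  simpa only [map_sum, insert_tmul] using congrArg (insert F y x) (sum_tmul_mate F φ ψ h)

/-- The comultiplication, as a map of abelian groups. -/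
noncomputable def comulAddHom : (envRing F).carrier →+ (envRing F).Square :=
  lift (fun X => AddMonoidHom.ofBiadditive (fun y x => insert F y x (dualBasis F X))
      (fun y x x' => by
        simp only [dualBasis_eq_sum, map_sum, insert_tmul, cls_add, BalTensor.tmul_add,
          Finset.sum_add_distrib])
      (fun y y' x => by
        simp only [dualBasis_eq_sum, map_sum, insert_tmul, add_cls, BalTensor.add_tmul,
          Finset.sum_add_distrib]))
    fun {X Y} g y x => by
      simp only [AddMonoidHom.ofBiadditive_apply, dualBasis_eq_sum, map_sum, insert_tmul,
        cls_dualMap]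
      -- After the coend relation is applied on the outside, the two sides differ only in which side
      -- of the inserted dual basis carries g; transposition exchanges them.
      rw [sum_insert_mate F y x (F.map g) (F.map (dualMap g)) (dualMap_pairing F g)]
      simp only [cls_dualMap]

theorem comulAddHom_cls (X : C) (y : F.obj (dual X)) (x : F.obj X) :
    comulAddHom F (cls F X y x) = insert F y x (dualBasis F X) :=
  lift_mk _ _ _ _ _

theorem comulAddHom_cls_sum (X : C) (y : F.obj (dual X)) (x : F.obj X) :
    comulAddHom F (cls F X y x) =
      ∑ i, BalTensor.tmul R (cls F X y (basisFst F X i)) (cls F X (basisSnd F X i) x) := by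
  simp only [comulAddHom_cls, dualBasis_eq_sum, map_sum, insert_tmul]

/-- The comultiplication. -/
noncomputable def comul : BimodHom R (envRing F).carrier (envRing F).Square where
  toAddMonoidHom := comulAddHom F
  map_smul' r h := by
    change comulAddHom F _ = r • comulAddHom F h
    induction h using cls_induction with
    | zero => simp only [smul_zero, map_zero]
    | cls X y x =>
      simp only [smul_cls, comulAddHom_cls_sum, Finset.smul_sum, BalTensor.smul_tmul']
    | add a b ha hb => simp only [smul_add, map_add, ha, hb]
  map_op_smul' r h := by
    change comulAddHom F _ = r • comulAddHom F h
    induction h using cls_induction with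
    | zero => simp only [smul_zero, map_zero]
    | cls X y x =>
      simp only [op_smul_cls, comulAddHom_cls_sum, Finset.smul_sum, BalTensor.op_smul_tmul]
    | add a b ha hb => simp only [smul_add, map_add, ha, hb]

theorem comul_cls (X : C) (y : F.obj (dual X)) (x : F.obj X) :
    comul F (cls F X y x) = insert F y x (dualBasis F X) :=
  comulAddHom_cls F X y x

theorem comul_cls_sum (X : C) (y : F.obj (dual X)) (x : F.obj X) :
    comul F (cls F X y x) =
      ∑ i, BalTensor.tmul R (cls F X y (basisFst F X i)) (cls F X (basisSnd F X i) x) :=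
  comulAddHom_cls_sum F X y x

/-- The counit, as a map of abelian groups. -/
noncomputable def counitAddHom : (envRing F).carrier →+ R :=
  lift (fun X => pairingHom F X) fun g y x => dualMap_pairing F g y x

theorem counitAddHom_cls (X : C) (y : F.obj (dual X)) (x : F.obj X) :
    counitAddHom F (cls F X y x) = pairing F y x :=
  lift_mk _ _ _ _ _

/-- The counit. -/
noncomputable def counit : BimodHom R (envRing F).carrier R where
  toAddMonoidHom := counitAddHom F
  map_smul' r h := by
    change counitAddHom F _ = r • counitAddHom F h
    induction h using cls_induction with
    | zero => simp only [smul_zero, map_zero]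
    | cls X y x => simp only [smul_cls, counitAddHom_cls, smul_pairing, smul_eq_mul]
    | add a b ha hb => simp only [smul_add, map_add, ha, hb]
  map_op_smul' r h := by
    change counitAddHom F _ = r • counitAddHom F h
    induction h using cls_induction with
    | zero => simp only [smul_zero, map_zero]
    | cls X y x =>
      obtain ⟨r, rfl⟩ := op_surjective r
      simp only [op_smul_cls, counitAddHom_cls, pairing_op_smul, op_smul_eq_mul]
    | add a b ha hb => simp only [smul_add, map_add, ha, hb]

theorem counit_cls (X : C) (y : F.obj (dual X)) (x : F.obj X) :
    counit F (cls F X y x) = pairing F y x :=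
  counitAddHom_cls F X y x

/-- Left multiplication by s(r) acts on x, which Δ keeps in the second factor; dually, t(r) acts on
y, kept in the first. These two facts make the maps in the antipode axioms balanced. -/
theorem comul_source_mul (r : R) (h : (envRing F).carrier) :
    comul F ((envRing F).source r * h) = (envRing F).mulSnd ((envRing F).source r) (comul F h) := by
  induction h using cls_induction with
  | zero => simp only [mul_zero, map_zero]
  | cls X y x =>
    simp only [source_mul_cls, comul_cls_sum, map_sum, EnvRing.mulSnd_tmul]
  | add a b ha hb => simp only [_root_.mul_add, map_add, ha, hb]

theorem comul_target_mul (r : R) (h : (envRing F).carrier) :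
    comul F ((envRing F).target (op r) * h) =
      (envRing F).mulFst ((envRing F).target (op r)) (comul F h) := by
  induction h using cls_induction with
  | zero => simp only [mul_zero, map_zero]
  | cls X y x =>
    simp only [target_mul_cls, comul_cls_sum, map_sum, EnvRing.mulFst_tmul]
  | add a b ha hb => simp only [_root_.mul_add, map_add, ha, hb]

/-- The left action of r on FX is the mate of the right action of r on FX*, because ⟨y·r, x⟩ = ⟨y,
r·x⟩. -/
theorem comul_takeuchi (r : R) (h : (envRing F).carrier) :
    (envRing F).mulFst ((envRing F).source r) (comul F h) =
      (envRing F).mulSnd ((envRing F).target (op r)) (comul F h) := by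
  induction h using cls_induction with
  | zero => simp only [map_zero]
  | cls X y x =>
    simp only [comul_cls_sum, map_sum, EnvRing.mulFst_tmul, EnvRing.mulSnd_tmul, source_mul_cls,
      target_mul_cls]
    exact sum_insert_mate F y x (r • ·) (op r • ·) (op_smul_pairing F r)
  | add a b ha hb => simp only [map_add, ha, hb]

theorem comul_cls_mul (X : C) (y : F.obj (dual X)) (x : F.obj X) (h : (envRing F).carrier) :
    comul F (cls F X y x * h) = ∑ i, (envRing F).mulFst (cls F X y (basisFst F X i))
      ((envRing F).mulSnd (cls F X (basisSnd F X i) x) (comul F h)) := by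
  induction h using cls_induction with
  | zero => simp only [mul_zero, map_zero, Finset.sum_const_zero]
  | cls X' y' x' =>
    rw [cls_mul_cls, comul_cls, comul_cls_sum]
    simp only [dualBasis_tensor, map_sum, insert_tmul, Fintype.sum_prod_type, EnvRing.mulFst_tmul,
      EnvRing.mulSnd_tmul, cls_mul_cls]
  | add a b ha hb => simp only [_root_.mul_add, map_add, ha, hb, Finset.sum_add_distrib]

theorem comul_mul (h h' : (envRing F).carrier) :
    comul F (h * h') =
      (envRing F).mulTakeuchi (comul F h') (fun r => comul_takeuchi F r h') (comul F h) := by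
  induction h using cls_induction with
  | zero => simp only [MulZeroClass.zero_mul, map_zero]
  | cls X y x =>
    simp only [comul_cls_mul, comul_cls_sum F X, map_sum, EnvRing.mulTakeuchi_tmul]
  | add a b ha hb => simp only [_root_.add_mul, map_add, ha, hb]

/-- The right bialgebroid structure on the coend. -/
noncomputable def bialgebroid : RightBialgebroid.{w, max u w} R where
  toEnvRing := envRing F
  comul := comul F
  counit := counit F
  coassoc h := by
    induction h using cls_induction with
    | zero => simp only [map_zero]
    | cls X y x =>
      simp only [comul_cls_sum, map_sum, BalTensor.bimodMap_tmul, BimodHom.id_apply,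
        BalTensor.sum_tmul, BalTensor.tmul_sum, BalTensor.assocHom_tmul]
      -- Both sides are ∑ (y ⊗ xᵢ) ⊗ (yᵢ ⊗ xⱼ) ⊗ (yⱼ ⊗ x), summed in different orders.
      exact Finset.sum_comm
    | add a b ha hb => simp only [map_add, ha, hb]
  counit_comul h := by
    induction h using cls_induction with
    | zero => simp only [map_zero]
    | cls X y x =>
      simp only [comul_cls_sum, map_sum, BalTensor.bimodMap_tmul, BimodHom.id_apply,
        BalTensor.lidHom_tmul, counit_cls, smul_cls, ← sum_cls, sum_pairing_basisSnd]
    | add a b ha hb => simp only [map_add, ha, hb]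
  comul_counit h := by
    induction h using cls_induction with
    | zero => simp only [map_zero]
    | cls X y x =>
      simp only [comul_cls_sum, map_sum, BalTensor.bimodMap_tmul, BimodHom.id_apply,
        BalTensor.ridHom_tmul, counit_cls, op_smul_cls, ← cls_sum, sum_pairing_basisFst]
    | add a b ha hb => simp only [map_add, ha, hb]
  takeuchi := comul_takeuchi F
  comul_one := by
    rw [one_eq_cls, comul_cls, dualBasis_unit, insert_tmul]
  comul_mul h h' m n a b a' b' hab hab' := by
    rw [comul_mul, hab, map_sum]
    refine Finset.sum_congr rfl fun i _ => ?_
    -- `mulTakeuchi` is defined on the balanced tensor product, so arbitrary expansions of Δ(h) and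
    -- Δ(h') may be inserted.
    rw [EnvRing.mulTakeuchi_tmul, hab', map_sum, map_sum]
    rfl
  counit_one := by
    rw [one_eq_cls, counit_cls, dualUnit_pairing, one_mul]
  counit_source_mul h h' := by
    induction h' using cls_induction with
    | zero => simp only [mul_zero]
    | cls X' y' x' =>
      induction h using cls_induction with
      | zero => simp only [map_zero, MulZeroClass.zero_mul]
      | cls X y x => rw [counit_cls, source_mul_cls, counit_cls, cls_mul_cls, counit_cls, dualMul_pairing]
      | add a b ha hb => simp only [map_add, _root_.add_mul, ha, hb]
    | add a b ha hb => simp only [map_add, _root_.mul_add, ha, hb]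
  counit_target_mul h h' := by
    induction h' using cls_induction with
    | zero => simp only [mul_zero]
    | cls X' y' x' =>
      induction h using cls_induction with
      | zero => simp only [map_zero, MulOpposite.op_zero, MulZeroClass.zero_mul]
      | cls X y x =>
        rw [counit_cls, target_mul_cls, counit_cls, cls_mul_cls, counit_cls, dualMul_pairing,
          op_smul_pairing]
      | add a b ha hb => simp only [map_add, MulOpposite.op_add, _root_.add_mul, ha, hb]
    | add a b ha hb => simp only [map_add, _root_.mul_add, ha, hb]

end DualCoend

/-! ### The pivotal isomorphism on elements. -/

namespace FiberFunctor

variable {C : Type u} [Category.{v} C] [MonoidalCategory C] [RightRigidCategory C]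
variable {R : Type w} [Ring R] (F : C ⥤ BimodCat.{w} R) [F.Monoidal]

theorem dualMap_hom_dualMap_inv {X Y : C} (i : X ≅ Y) (y : F.obj (dual X)) :
    F.map (dualMap i.hom) (F.map (dualMap i.inv) y) = y := by
  refine pairing_ext F fun x => ?_
  rw [dualMap_pairing, dualMap_pairing, map_hom_inv_apply]

theorem map_dualTensorIso_hom_mul {X Y : C} (y : F.obj (dual X)) (y' : F.obj (dual Y)) :
    F.map (dualTensorIso X Y).hom (mul F y' y) = dualMul F y y' := rfl

theorem map_dualTensorIso_inv_dualMul {X Y : C} (y : F.obj (dual X)) (y' : F.obj (dual Y)) :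
    F.map (dualTensorIso X Y).inv (dualMul F y y') = mul F y' y :=
  map_hom_inv_apply F _ _

variable (θ : MonoidalDoubleDualIso C)

/-- The action of `ϑ_X : X ⟶ X**` on elements. -/
def toDoubleDual (X : C) : BimodHom R (F.obj X) (F.obj (dual (dual X))) := F.map (θ.iso X).hom

theorem toDoubleDual_map {X Y : C} (f : X ⟶ Y) (x : F.obj X) :
    toDoubleDual F θ Y (F.map f x) = F.map (dualMap (dualMap f)) (toDoubleDual F θ X x) := by
  have h := map_comp_apply F f (θ.iso Y).hom x
  rw [θ.naturality, map_comp_apply] at h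
  exact h.symm

theorem toDoubleDual_unit (r : R) :
    toDoubleDual F θ (𝟙_ C) (unit F r) = F.map (dualMap (dualUnitIso C).inv) (dualUnit F r) := by
  change F.map (θ.iso (𝟙_ C)).hom _ = _
  rw [θ.unit, map_comp_apply]
  rfl

theorem toDoubleDual_mul {X Y : C} (x : F.obj X) (y : F.obj Y) :
    toDoubleDual F θ (X ⊗ Y) (mul F x y) = F.map (dualMap (dualTensorIso X Y).inv)
      (dualMul F (toDoubleDual F θ Y y) (toDoubleDual F θ X x)) := by
  change F.map (θ.iso (X ⊗ Y)).hom _ = _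
  rw [θ.tensor, map_comp_apply, map_comp_apply, map_tensor_mul]
  rfl

theorem dualMap_dualEv_dualUnit_one (X : C) :
    F.map (dualMap (dualEv X)) (dualUnit F 1) =
      ∑ i, dualMul F (basisSnd F (dual X) i) (basisFst F (dual X) i) := by
  refine dualMap_dualUnit_one F _ _ _ fun y x => ?_
  simp only [← op_smul_pairing, ← sum_pairing, sum_pairing_basisFst]
  rfl

/-- The scalar r = ⟨y, x⟩ is recovered by pairing ϑ(F₀(r)) with G₀(1). Since F₀(r) = F ev_X(y·x),
naturality moves ev_X onto G₀(1), where it produces the dual basis of X*; monoidality splits ϑ(y·x),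
and the dual basis sums to ⟨ϑy, ϑx⟩. -/
theorem toDoubleDual_pairing {X : C} (y : F.obj (dual X)) (x : F.obj X) :
    pairing F (toDoubleDual F θ (dual X) y) (toDoubleDual F θ X x) = pairing F y x := by
  have h : ∀ r, pairing F (toDoubleDual F θ (𝟙_ C) (unit F r)) (dualUnit F 1) = r := fun r => by
    rw [toDoubleDual_unit, dualMap_pairing, dualUnit, dualUnit, map_hom_inv_apply]
    exact (dualUnit_pairing F r 1).trans (mul_one r)
  rw [← h (pairing F y x), ← map_dualEv_mul, toDoubleDual_map, dualMap_pairing,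
    dualMap_dualEv_dualUnit_one, toDoubleDual_mul, dualMap_pairing, map_sum]
  simp only [map_dualTensorIso_inv_dualMul, pairing_sum]
  -- Here ϑx is expanded in the dual basis of X*, matching ⟨ϑx·ϑy, xᵢ·yᵢ⟩ = ⟨ϑy, ⟨ϑx, xᵢ⟩yᵢ⟩.
  conv_lhs => rw [← sum_pairing_basisSnd F (toDoubleDual F θ X x), pairing_sum]
  exact Finset.sum_congr rfl fun i _ => (dualMul_pairing F _ _ _ _).symm

theorem dualMap_toDoubleDual {X : C} (y : F.obj (dual X)) :
    F.map (dualMap (θ.iso X).hom) (toDoubleDual F θ (dual X) y) = y := by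
  refine pairing_ext F fun x => ?_
  rw [dualMap_pairing]
  exact toDoubleDual_pairing F θ y x

/-- The tensor ∑ yᵢ·ϑ(xᵢ) represents the form (x, z) ↦ ⟨ϑx, z⟩, as xᵢ⟨yᵢ, x⟩ sums to x under ϑ. It
supplies the contraction in (S-4). -/
theorem sum_dualMul_toDoubleDual (X : C) :
    ∑ i, dualMul F (basisSnd F X i) (toDoubleDual F θ X (basisFst F X i)) =
      F.map (dualMap ((θ.iso X).hom ▷ dual X ≫ dualEv (dual X))) (dualUnit F 1) := by
  refine (dualMap_dualUnit_one F _ _ _ fun x y => ?_).symm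
  simp only [← op_smul_pairing, ← sum_pairing, ← BimodHom.map_op_smul, ← map_sum,
    sum_pairing_basisFst]
  rw [map_comp_apply, map_whiskerRight_mul]
  rfl

end FiberFunctor

/-! ### The antipode and its axioms. -/

namespace DualCoend

open FiberFunctor

variable {C : Type u} [Category.{v} C] [MonoidalCategory C] [RightRigidCategory C]
variable {R : Type w} [Ring R] (F : C ⥤ BimodCat.{w} R) [F.Monoidal]
variable (θ : MonoidalDoubleDualIso C)

/-- The antipode `y ⊗_X x ↦ ϑ(x) ⊗_{X*} y`, as a map of abelian groups. -/
noncomputable def antipodeHom : (envRing F).carrier →+ (envRing F).carrier :=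
  lift (fun X => AddMonoidHom.ofBiadditive (fun y x => cls F (dual X) (toDoubleDual F θ X x) y)
      (fun y x x' => by rw [map_add, add_cls]) (fun y y' x => cls_add F _ _ _ _))
    fun g y x => by
      simp only [AddMonoidHom.ofBiadditive_apply]
      rw [toDoubleDual_map, cls_dualMap]

theorem antipodeHom_cls (X : C) (y : F.obj (dual X)) (x : F.obj X) :
    antipodeHom F θ (cls F X y x) = cls F (dual X) (toDoubleDual F θ X x) y :=
  lift_mk _ _ _ _ _

theorem antipodeHom_antipodeHom (h : (envRing F).carrier) :
    antipodeHom F θ (antipodeHom F θ h) = h := by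
  induction h using cls_induction with
  | zero => simp only [map_zero]
  | cls X y x =>
    rw [antipodeHom_cls, antipodeHom_cls]
    -- S²(y ⊗ x) = ϑy ⊗ ϑx over X**; the coend relation for ϑ_X pulls it back to (ϑ_X)*(ϑy) ⊗ x over
    -- X.
    refine (cls_dualMap F (θ.iso X).hom _ x).symm.trans ?_
    rw [dualMap_toDoubleDual]
  | add a b ha hb => simp only [map_add, ha, hb]

theorem antipodeHom_target (r : R) :
    antipodeHom F θ ((envRing F).target (op r)) = (envRing F).source r := by
  rw [target_eq_cls, antipodeHom_cls, dualUnit, ← cls_dualMap, toDoubleDual_unit,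
    dualMap_hom_dualMap_inv, source_eq_cls]

theorem antipodeHom_source (r : R) :
    antipodeHom F θ ((envRing F).source r) = (envRing F).target (op r) := by
  rw [← antipodeHom_target F θ, antipodeHom_antipodeHom]

theorem antipodeHom_mul (h h' : (envRing F).carrier) :
    antipodeHom F θ (h * h') = antipodeHom F θ h' * antipodeHom F θ h := by
  induction h using cls_induction with
  | zero => simp only [MulZeroClass.zero_mul, MulZeroClass.mul_zero, map_zero]
  | cls X y x =>
    induction h' using cls_induction with
    | zero => simp only [MulZeroClass.zero_mul, MulZeroClass.mul_zero, map_zero]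
    | cls X' y' x' =>
      simp only [cls_mul_cls, antipodeHom_cls]
      -- The v hidden in y·y' crosses the coend and cancels the (v⁻¹)* from monoidality of ϑ,
      -- leaving a product over B* ⊗ A* in reversed order.
      rw [toDoubleDual_mul, ← map_dualTensorIso_hom_mul F y y', ← cls_dualMap, dualMap_hom_dualMap_inv]
    | add a b ha hb => simp only [_root_.mul_add, _root_.add_mul, map_add, ha, hb]
  | add a b ha hb => simp only [_root_.mul_add, _root_.add_mul, map_add, ha, hb]

/-- The antipode. -/
noncomputable def antipode : (envRing F).carrier ≃+ (envRing F).carrier :=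
  { antipodeHom F θ with
    invFun := antipodeHom F θ
    left_inv := antipodeHom_antipodeHom F θ
    right_inv := antipodeHom_antipodeHom F θ }

/-- The map `a ⊗ b ↦ S(b)₁ ⊗ a S(b)₂`. -/
noncomputable def mulSndAntipode : (envRing F).Square →+ (envRing F).Square :=
  BalTensor.lift (AddMonoidHom.ofBiadditive
      (fun a b => (envRing F).mulSnd a (comul F (antipodeHom F θ b)))
      (fun a b b' => by rw [map_add, map_add, map_add])
      (fun a a' b => EnvRing.mulSnd_add _ a a' _))
    fun a r b => by
      simp only [AddMonoidHom.ofBiadditive_apply, EnvRing.op_smul_def, EnvRing.smul_def, unop_op]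
      -- S(b t(r)) = s(r)S(b), and Δ places s(r) in the second factor, where it joins a on its
      -- right.
      rw [antipodeHom_mul, antipodeHom_target, comul_source_mul, EnvRing.mulSnd_mul]

theorem mulSndAntipode_tmul (a b : (envRing F).carrier) :
    mulSndAntipode F θ (BalTensor.tmul R a b) =
      (envRing F).mulSnd a (comul F (antipodeHom F θ b)) := rfl

theorem mulSndAntipode_comul (h : (envRing F).carrier) :
    mulSndAntipode F θ (comul F h) = BalTensor.tmul R (antipodeHom F θ h) 1 := by
  induction h using cls_induction with
  | zero => simp only [map_zero, BalTensor.zero_tmul]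
  | cls X y x =>
    -- The sum ∑ xᵢ·yᵢ is F db_X(F₀(1)); moving db_X across the coend contracts y and z to the
    -- scalar ⟨z, y⟩ in the target.
    have key : ∀ z : F.obj (dual (dual X)),
        ∑ i, cls F X y (basisFst F X i) * cls F (dual X) z (basisSnd F X i) =
          pairing F z y • (1 : (envRing F).carrier) := fun z => by
      simp only [cls_mul_cls, ← cls_sum]
      rw [← map_dualDb_unit_one, ← cls_dualMap, dualMap_dualDb_dualMul, one_eq_cls, smul_cls,
        smul_dualUnit, mul_one]
    simp only [comul_cls_sum F X, map_sum, mulSndAntipode_tmul, antipodeHom_cls,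
      comul_cls_sum F (dual X), EnvRing.mulSnd_tmul]
    rw [Finset.sum_comm]
    simp only [← BalTensor.tmul_sum, key, ← BalTensor.smul_tmul, ← BalTensor.sum_tmul,
      op_smul_cls, ← cls_sum, sum_pairing_basisFst]
  | add a b ha hb => simp only [map_add, BalTensor.add_tmul, ha, hb]

/-- The map `a ⊗ b ↦ b S(a)₁ ⊗ S(a)₂`. -/
noncomputable def mulFstAntipode : (envRing F).Square →+ (envRing F).Square :=
  BalTensor.lift (AddMonoidHom.ofBiadditive
      (fun a b => (envRing F).mulFst b (comul F (antipodeHom F θ a)))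
      (fun a b b' => EnvRing.mulFst_add _ b b' _)
      (fun a a' b => by rw [map_add, map_add, map_add]))
    fun a r b => by
      simp only [AddMonoidHom.ofBiadditive_apply, EnvRing.op_smul_def, EnvRing.smul_def, unop_op]
      rw [antipodeHom_mul, antipodeHom_source, comul_target_mul, EnvRing.mulFst_mul]

theorem mulFstAntipode_tmul (a b : (envRing F).carrier) :
    mulFstAntipode F θ (BalTensor.tmul R a b) =
      (envRing F).mulFst b (comul F (antipodeHom F θ a)) := rfl

theorem mulFstAntipode_comul (h : (envRing F).carrier) :
    mulFstAntipode F θ (comul F h) = BalTensor.tmul R 1 (antipodeHom F θ h) := by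
  induction h using cls_induction with
  | zero => simp only [map_zero, BalTensor.tmul_zero]
  | cls X y x =>
    -- The form ev_{X*} ∘ (ϑ_X ⊗ 1) moves across the coend onto x·z, leaving the scalar ⟨ϑx, z⟩ in
    -- the source.
    have key : ∀ z : F.obj (dual X),
        ∑ i, cls F X (basisSnd F X i) x *
            cls F (dual X) (toDoubleDual F θ X (basisFst F X i)) z =
          op (pairing F (toDoubleDual F θ X x) z) • (1 : (envRing F).carrier) := fun z => by
      simp only [cls_mul_cls, ← sum_cls]
      rw [sum_dualMul_toDoubleDual, cls_dualMap, map_comp_apply, map_whiskerRight_mul,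
        map_dualEv_mul, one_eq_cls, op_smul_cls, op_smul_unit, one_mul]
      rfl
    simp only [comul_cls_sum F X, map_sum, mulFstAntipode_tmul, antipodeHom_cls,
      comul_cls_sum F (dual X), EnvRing.mulFst_tmul]
    rw [Finset.sum_comm]
    simp only [← BalTensor.sum_tmul, key, BalTensor.smul_tmul, ← BalTensor.tmul_sum,
      smul_cls, ← sum_cls, sum_pairing_basisSnd]
  | add a b ha hb => simp only [map_add, BalTensor.tmul_add, ha, hb]

/-- The balanced map `mulSndAntipode` makes the sum independent of the expansion of Δ(h). -/
theorem sum_mulSnd_comul_antipodeHom (h : (envRing F).carrier) (n : ℕ)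
    (a b : Fin n → (envRing F).carrier) (hab : comul F h = ∑ i, BalTensor.tmul R (a i) (b i)) :
    ∑ i, (envRing F).mulSnd (a i) (comul F (antipodeHom F θ (b i))) =
      BalTensor.tmul R (antipodeHom F θ h) 1 := by
  simp only [← mulSndAntipode_comul, hab, map_sum, mulSndAntipode_tmul]

theorem sum_mulFst_comul_antipodeHom (h : (envRing F).carrier) (n : ℕ)
    (a b : Fin n → (envRing F).carrier) (hab : comul F h = ∑ i, BalTensor.tmul R (a i) (b i)) :
    ∑ i, (envRing F).mulFst (b i) (comul F (antipodeHom F θ (a i))) =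
      BalTensor.tmul R 1 (antipodeHom F θ h) := by
  simp only [← mulFstAntipode_comul, hab, map_sum, mulFstAntipode_tmul]

theorem isAntipode_antipode : (bialgebroid F).IsAntipode (antipode F θ) where
  map_target := antipodeHom_target F θ
  map_mul := antipodeHom_mul F θ
  antipode := sum_mulSnd_comul_antipodeHom F θ
  antipode_symm := sum_mulFst_comul_antipodeHom F θ

end DualCoend

/-! ### Assembly. -/

theorem mainTheorem5
    {C : Type u} [Category.{v} C] [Preadditive C] [Limits.HasFiniteBiproducts C]
    [MonoidalCategory C] [MonoidalPreadditive C] [RightRigidCategory C]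
    (θ : MonoidalDoubleDualIso C)
    {R : Type w} [Ring R]
    (F : C ⥤ BimodCat.{w} R) [F.Additive] [F.Monoidal]
    (hF : ∀ X : C, Nonempty (HasRightDual (F.obj X))) :
    ∃ (H : RightBialgebroid.{w, max u w} R) (e : DualCoend F ≃+ H.carrier),
      (∀ r : R, H.source r =
        e (DualCoend.mk F (𝟙_ C) (FiberFunctor.dualUnit F 1) (FiberFunctor.unit F r))) ∧
      (∀ r : R, H.target (op r) =
        e (DualCoend.mk F (𝟙_ C) (FiberFunctor.dualUnit F r) (FiberFunctor.unit F 1))) ∧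
      (∀ (A B : C) (y : F.obj (dual A)) (x : F.obj A) (y' : F.obj (dual B)) (x' : F.obj B),
        e (DualCoend.mk F A y x) * e (DualCoend.mk F B y' x') =
          e (DualCoend.mk F (A ⊗ B) (FiberFunctor.dualMul F y y') (FiberFunctor.mul F x x'))) ∧
      (∀ (B : C) (y : F.obj (dual B)) (x : F.obj B)
        (n : ℕ) (a : Fin n → F.obj B) (b : Fin n → F.obj (dual B)),
        FiberFunctor.dualBasis F B = ∑ i, BalTensor.tmul R (a i) (b i) →
        H.comul (e (DualCoend.mk F B y x)) =
          ∑ i, BalTensor.tmul R (e (DualCoend.mk F B y (a i))) (e (DualCoend.mk F B (b i) x))) ∧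
      (∀ (B : C) (y : F.obj (dual B)) (x : F.obj B),
        H.counit (e (DualCoend.mk F B y x)) = FiberFunctor.pairing F y x) ∧
      ∃ S : H.carrier ≃+ H.carrier,
        (∀ (B : C) (y : F.obj (dual B)) (x : F.obj B),
          S (e (DualCoend.mk F B y x)) =
            e (DualCoend.mk F (dual B) (F.map (θ.iso B).hom x) y)) ∧
        H.IsAntipode S ∧
        ∀ h : H.carrier, S (S h) = h := by
  refine ⟨DualCoend.bialgebroid F, AddEquiv.refl (DualCoend F), fun r => rfl, fun r => rfl,
    DualCoend.mk_mul_mk F, fun B y x n a b hab => ?_, DualCoend.counit_cls F,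
    DualCoend.antipode F θ, DualCoend.antipodeHom_cls F θ, DualCoend.isAntipode_antipode F θ,
    DualCoend.antipodeHom_antipodeHom F θ⟩
  -- The formula for Δ holds for any expansion of the dual basis, since Δ is the image of the dual
  -- basis under an additive map.
  have h := DualCoend.comul_cls F B y x
  rw [hab, map_sum] at h
  exact h
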